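/- Consider the boundary regression model $Y_i=g(x_i)+\epsilon_i$, $i=1,\dots,n$, for even sample sizes $n$ (all limits and $O$-statements are for $n\to\infty$ along even $n$). The regression function $g$ is affine (null hypothesis). The real design points $x_i=x_{n,i}$ all lie in one fixed bounded interval. For every $n$ the errors $\epsilon_i=\epsilon_{n,i}$, $1\le i\le n$, are i.i.d. with a distribution function $F$ that does not depend on $n$ and with $\mathbb P(\epsilon_i<0)=1$. Let $\gamma>0$ and assume that there are constants $C_F\in\mathbb R$ and $\Gamma,\tilde C_F>0$ with $$|F(z)-(1-\gamma|z|)|\le C_F|z|^2\quad\text{and}\quad F(z)\le\tilde C_F|z|^{-\Gamma}\qquad\text{for all }z<0$$ (the first condition implies $\lim_{t\uparrow0}(1-F(t))/|t|=\gamma$). Let $h=h(n)>0$ and $h_1=h_1(n)>0$ be bandwidths and $k=k(n)\ge1$ integers with $h\to0$ and $nh\to\infty$. Assume $$\liminf_{n\to\infty}\frac{\inf\{\#\{i\in\{1,\dots,n\}: x_i\in[x,x+h/2)\}: x\in(-h,1+h/2)\}}{nh}>0,$$ $$\limsup_{n\to\infty}\frac{n^2h^2}{h_1^5k^4}<\infty,\qquad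 \lim_{n\to\infty}n^\alpha\frac{nh}{k}=0\ \text{ for some }\alpha>0,\qquad \lim_{n\to\infty}\frac{k^2h}{n}=0 .$$ Let $\hat g(x)$ be the minimal $p_0$ for which there is $p_1$ with $Y_{2i}\le p_0+p_1(x_{2i}-x)$ for all $i\in\{1,\dots,n/2\}$ with $|x-x_{2i}|<h_1$. Let $\hat\epsilon_{1:n/2}\le\dots\le\hat\epsilon_{n/2:n/2}$ be the order statistics of the residuals $\hat\epsilon_{2i}=Y_{2i}-\hat g(x_{2i})$, $i=1,\dots,n/2$, and put $$\hat\gamma=\frac{2k/n}{\hat\epsilon_{n/2:n/2}-\hat\epsilon_{n/2-k:n/2}}$$ (defined as soon as $k<n/2$, which holds for all large $n$; $1/\hat\gamma$ is read as $0$ if the denominator vanishes). Then $(1/\hat\gamma-1/\gamma)^4$ is integrable for all sufficiently large even $n$, and $$\mathbb E\big[(1/\hat\gamma-1/\gamma)^4\big]=O\big((nh)^{-2}\big).$$ -/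

import Mathlib

open MeasureTheory ProbabilityTheory Filter Topology Asymptotics

/-- The sample size `n` tends to infinity along the even numbers (half of the sample is used for
the estimation of the regression function). -/
def evenTop : Filter ℕ := atTop ⊓ 𝓟 {n : ℕ | Even n}

/-- The levels `p₀` of the lines `y ↦ p₀ + p₁ (y - t)` that lie above all observations with an even
index `2i ≤ n` whose design point has distance less than `b` from `t`. -/
def upperLevels (n : ℕ) (x Y : ℕ → ℝ) (b t : ℝ) : Set ℝ :=
  {p₀ | ∃ p₁ : ℝ, ∀ i ∈ Finset.Icc 1 (n / 2), |t - x (2 * i)| < b →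
    Y (2 * i) ≤ p₀ + p₁ * (x (2 * i) - t)}

/-- The local linear boundary estimator with bandwidth `b` at the point `t`: the minimal `p₀` such
that some line through `(t, p₀)` lies above the observations in the window. -/
noncomputable def boundaryEstimator (n : ℕ) (x Y : ℕ → ℝ) (b t : ℝ) : ℝ :=
  sInf (upperLevels n x Y b t)

/-- The residuals at the even indices; the entry with number `i : Fin (n / 2)` (counted from `0`)
belongs to the index `2 (i + 1)`. -/
noncomputable def boundaryResidual (n : ℕ) (x Y : ℕ → ℝ) (b : ℝ) (i : Fin (n / 2)) : ℝ :=
  Y (2 * ((i : ℕ) + 1)) - boundaryEstimator n x Y b (x (2 * ((i : ℕ) + 1)))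

/-- The `j`-th smallest (`1 ≤ j ≤ m`) of the numbers `v 0, …, v (m - 1)`; `0` for other `j`. -/
noncomputable def orderStat {m : ℕ} (v : Fin m → ℝ) (j : ℕ) : ℝ :=
  if hj : 1 ≤ j ∧ j - 1 < m then v (Tuple.sort v ⟨j - 1, hj.2⟩) else 0

/-- The estimator of negative Hill type, formed from the residuals with bandwidth `b`. -/
noncomputable def negHill (n k : ℕ) (x Y : ℕ → ℝ) (b : ℝ) : ℝ :=
  (2 * (k : ℝ) / (n : ℝ)) /
    (orderStat (boundaryResidual n x Y b) (n / 2) -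
      orderStat (boundaryResidual n x Y b) (n / 2 - k))

/-- The number of design points `x 1, …, x n` in `[t, t + b / 2)`. -/
noncomputable def designCount (n : ℕ) (x : ℕ → ℝ) (b t : ℝ) : ℕ :=
  Set.ncard {i : ℕ | i ∈ Finset.Icc 1 n ∧ x i ∈ Set.Ico t (t + b / 2)}

/-- The smallest number of design points in an interval `[t, t + b / 2)` with
`t ∈ (-b, 1 + b / 2)`. -/
noncomputable def minDesignCount (n : ℕ) (x : ℕ → ℝ) (b : ℝ) : ℕ :=
  sInf (designCount n x b '' Set.Ioo (-b) (1 + b / 2))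

/-- The lower scatter constant of the designs `x n 1, …, x n n`, relative to the bandwidths
`h n`. -/
noncomputable def scatterConstant (x : ℕ → ℕ → ℝ) (h : ℕ → ℝ) : EReal :=
  liminf (fun n : ℕ => (((minDesignCount n (x n) (h n) : ℝ) / ((n : ℝ) * h n) : ℝ) : EReal))
    evenTop

/-! ### Order statistics -/

/-! Put `m = n / 2` and `δ = (nh)^(-1/2)`. Changing the slope of the competing lines absorbs an
affine `g`, so the residuals are functions of the errors alone, and `1/γ̂` is `m / k` times the
spacing between the residuals of rank `m` and `m - k`. It suffices that this rescaled spacing is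
within a constant times `δ` of `1/γ` outside an event of tiny probability.

Since the errors are nonpositive, each residual lies between its error and `0`; this bounds the
spacing above by minus the error of rank `m - k`. For the lower bound, cut the line into cells of
length `h₁`. If errors close to `0` occur on both sides of `x i` within its cell, no admissible line
is low at `x i` (`localResidual_le_of_two_sided`). With high probability the resulting excess of the
residual over the error is at most `cellRadius`, of order `w / rank` with ranks counted from both
ends of the cell. These radii sum to at most `w` times the number of cells times a logarithm
(`sum_inv_card_inCell_le`), however the design is spread. The first two rates make this `O(kδ)`, and
the third makes the quadratic error of `F` in the counts `O(kδ)` as well. Hence at the levels `k /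
(mγ) * (1 ± Aδ)` the expected exceedance counts differ from `k` by at least `kδ`, and Chernoff
bounds fail with probability at most `exp(-δ² k / 8)`, where `δ² k = k / (nh) ≥ n^α` eventually.

Off the good event, `X^4 ≤ λ X^8 + λ⁻¹` with `λ = n^(-11)` is enough: the eighth moment grows
polynomially (`neg_orderStat_pow_le`), while the exceptional probability beats every power of `n`.
-/

theorem continuous_of_monotone_of_add_const {ι : Type*} [Fintype ι] {f : (ι → ℝ) → ℝ}
    (hmono : Monotone f) (hadd : ∀ v c, f (fun i => v i + c) = f v + c) : Continuous f := by
  -- Coordinatewise `v ≤ w + dist v w`, so `f` is 1-Lipschitz for the sup distance. This yields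
  -- measurability of order statistics and of the boundary estimator.
  refine (LipschitzWith.of_le_add (f := f) fun v w => ?_).continuous
  rw [← hadd]
  refine hmono fun i => ?_
  have := (abs_le.1 ((Real.dist_eq _ _).symm.le.trans (dist_le_pi_dist v w i))).2
  linarith

/-- Sorting is a permutation, so it preserves the number of values below `t`, and in sorted order
these values form an initial segment. Order statistics are handled below through this count. -/
theorem orderStat_le_iff {m : ℕ} (v : Fin m → ℝ) {j : ℕ} (hj : 1 ≤ j) (hjm : j ≤ m) (t : ℝ) :
    orderStat v j ≤ t ↔ j ≤ (Finset.univ.filter fun i => v i ≤ t).card := by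
  have hj' : 1 ≤ j ∧ j - 1 < m := ⟨hj, by omega⟩
  rw [orderStat, dif_pos hj']
  have key := Tuple.lt_card_le_iff_apply_le_of_monotone (j := ⟨j - 1, hj'.2⟩) (a := t)
    (Tuple.monotone_sort v)
  simp only [Function.comp] at key
  rw [← key]
  have hc : (Finset.univ.filter fun i => v (Tuple.sort v i) ≤ t).card
      = (Finset.univ.filter fun i => v i ≤ t).card := by
    refine Finset.card_bij (fun i _ => Tuple.sort v i) ?_ ?_ ?_
    · intro a ha
      simpa using ha
    · intro a _ b _ hab
      exact (Tuple.sort v).injective hab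
    · intro b hb
      exact ⟨(Tuple.sort v).symm b, by simpa using hb, by simp⟩
  rw [hc]
  change j - 1 < _ ↔ _
  omega

theorem orderStat_monotone {m : ℕ} {j : ℕ} (hj : 1 ≤ j) (hjm : j ≤ m) :
    Monotone fun v : Fin m → ℝ => orderStat v j := by
  intro v w hvw
  change orderStat v j ≤ orderStat w j
  rw [orderStat_le_iff v hj hjm]
  refine ((orderStat_le_iff w hj hjm _).1 le_rfl).trans (Finset.card_le_card ?_)
  intro i hi
  simp only [Finset.mem_filter, Finset.mem_univ, true_and] at hi ⊢
  exact (hvw i).trans hi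

theorem orderStat_add_const {m : ℕ} {j : ℕ} (hj : 1 ≤ j) (hjm : j ≤ m) (v : Fin m → ℝ) (c : ℝ) :
    orderStat (fun i => v i + c) j = orderStat v j + c := by
  refine eq_of_forall_ge_iff fun t => ?_
  rw [orderStat_le_iff _ hj hjm, ← le_sub_iff_add_le, orderStat_le_iff _ hj hjm]
  simp only [le_sub_iff_add_le]

theorem measurable_orderStat {m : ℕ} {j : ℕ} (hj : 1 ≤ j) (hjm : j ≤ m) :
    Measurable fun v : Fin m → ℝ => orderStat v j :=
  (continuous_of_monotone_of_add_const (orderStat_monotone hj hjm)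
    (orderStat_add_const hj hjm)).measurable

/-- The order statistic of rank `m - k` lies below `t` if at most `k` values exceed `t`. -/
theorem orderStat_le_of_card_le {m k : ℕ} (hk : k < m) (v : Fin m → ℝ) {t : ℝ}
    (h : (Finset.univ.filter fun i => t < v i).card ≤ k) : orderStat v (m - k) ≤ t := by
  rw [orderStat_le_iff v (by omega) (by omega)]
  have := Finset.card_filter_add_card_filter_not (s := (Finset.univ : Finset (Fin m)))
    (fun i => v i ≤ t)
  simp only [not_le, Finset.card_univ, Fintype.card_fin] at this
  omega

/-- The order statistic of rank `m - k` lies above `t` if more than `k` values exceed `t`. -/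
theorem le_orderStat_of_lt_card {m k : ℕ} (hk : k < m) (v : Fin m → ℝ) {t : ℝ}
    (h : k < (Finset.univ.filter fun i => t < v i).card) : t ≤ orderStat v (m - k) := by
  by_contra! hlt
  have h1 := (orderStat_le_iff v (j := m - k) (by omega) (by omega) _).1 le_rfl
  have h2 : (Finset.univ.filter fun i => v i ≤ orderStat v (m - k)).card ≤
      (Finset.univ.filter fun i => v i ≤ t).card := by
    refine Finset.card_le_card fun i hi => ?_
    simp only [Finset.mem_filter, Finset.mem_univ, true_and] at hi ⊢
    linarith
  have := Finset.card_filter_add_card_filter_not (s := (Finset.univ : Finset (Fin m)))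
    (fun i => v i ≤ t)
  simp only [not_le, Finset.card_univ, Fintype.card_fin] at this
  omega

theorem le_orderStat_last {m : ℕ} (v : Fin m → ℝ) (i : Fin m) : v i ≤ orderStat v m := by
  have hm : 1 ≤ m := by have := i.2; omega
  have h1 := (orderStat_le_iff v hm le_rfl _).1 le_rfl
  by_contra! hlt
  have h2 : (Finset.univ.filter fun j => v j ≤ orderStat v m).card <
      (Finset.univ : Finset (Fin m)).card := by
    refine Finset.card_lt_card (Finset.filter_ssubset.2 ⟨i, Finset.mem_univ _, not_le.2 hlt⟩)
  simp only [Finset.card_univ, Fintype.card_fin] at h2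
  omega

theorem orderStat_le_of_forall {m j : ℕ} (hj : 1 ≤ j) (hjm : j ≤ m) (v : Fin m → ℝ) {t : ℝ}
    (h : ∀ i, v i ≤ t) : orderStat v j ≤ t := by
  rw [orderStat_le_iff v hj hjm, Finset.filter_true_of_mem fun i _ => h i]
  simpa using hjm

theorem orderStat_mono_rank {m j l : ℕ} (hj : 1 ≤ j) (hjl : j ≤ l) (hl : l ≤ m) (v : Fin m → ℝ) :
    orderStat v j ≤ orderStat v l := by
  rw [orderStat_le_iff v hj (hjl.trans hl)]
  exact hjl.trans ((orderStat_le_iff v (hj.trans hjl) hl _).1 le_rfl)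

/-! ### The boundary estimator at a design point -/

/-- The levels at `x i` of the lines above the data in the window around `x i`. -/
def localLevels {m : ℕ} (x : Fin m → ℝ) (b : ℝ) (e : Fin m → ℝ) (i : Fin m) : Set ℝ :=
  {p₀ | ∃ p₁ : ℝ, ∀ j, |x i - x j| < b → e j ≤ p₀ + p₁ * (x j - x i)}

theorem mem_localLevels_of_forall_le {m : ℕ} (x : Fin m → ℝ) (b : ℝ) {e : Fin m → ℝ} (i : Fin m)
    {t : ℝ} (h : ∀ j, e j ≤ t) : t ∈ localLevels x b e i :=
  ⟨0, fun j _ => by simpa using h j⟩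

theorem localLevels_nonempty {m : ℕ} (x : Fin m → ℝ) (b : ℝ) (e : Fin m → ℝ) (i : Fin m) :
    (localLevels x b e i).Nonempty :=
  ⟨_, mem_localLevels_of_forall_le x b i (le_orderStat_last e)⟩

theorem le_of_mem_localLevels {m : ℕ} {x : Fin m → ℝ} {b : ℝ} (hb : 0 < b) {e : Fin m → ℝ}
    {i : Fin m} {p : ℝ} (hp : p ∈ localLevels x b e i) : e i ≤ p := by
  obtain ⟨p₁, h⟩ := hp
  simpa using h i (by simpa using hb)

theorem localLevels_bddBelow {m : ℕ} (x : Fin m → ℝ) {b : ℝ} (hb : 0 < b) (e : Fin m → ℝ)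
    (i : Fin m) : BddBelow (localLevels x b e i) :=
  ⟨e i, fun _ hp => le_of_mem_localLevels hb hp⟩

/-- The slope change `p₁ ↦ p₁ + d` absorbs the added line; this is how the null hypothesis removes
`g` from the residuals. -/
theorem localLevels_affine {m : ℕ} (x : Fin m → ℝ) (b : ℝ) (e : Fin m → ℝ) (i : Fin m)
    (c d : ℝ) :
    localLevels x b (fun j => c + d * x j + e j) i
      = OrderIso.addRight (c + d * x i) '' localLevels x b e i := by
  ext p
  simp only [localLevels, Set.mem_ofPred_eq, Set.mem_image, OrderIso.addRight_apply]
  constructor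
  · rintro ⟨p₁, h⟩
    refine ⟨p - (c + d * x i), ⟨p₁ - d, fun j hj => ?_⟩, by ring⟩
    have := h j hj
    linarith
  · rintro ⟨q, ⟨p₁, h⟩, rfl⟩
    refine ⟨p₁ + d, fun j hj => ?_⟩
    have := h j hj
    linarith

theorem sInf_localLevels_affine {m : ℕ} (x : Fin m → ℝ) {b : ℝ} (hb : 0 < b) (e : Fin m → ℝ)
    (i : Fin m) (c d : ℝ) :
    sInf (localLevels x b (fun j => c + d * x j + e j) i)
      = sInf (localLevels x b e i) + (c + d * x i) := by
  rw [localLevels_affine, ← OrderIso.map_csInf' _ (localLevels_nonempty x b e i)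
    (localLevels_bddBelow x hb e i), OrderIso.addRight_apply]

/-- The residual at the design point `x i`. -/
noncomputable def localResidual {m : ℕ} (x : Fin m → ℝ) (b : ℝ) (e : Fin m → ℝ) (i : Fin m) : ℝ :=
  e i - sInf (localLevels x b e i)

theorem localResidual_affine {m : ℕ} (x : Fin m → ℝ) {b : ℝ} (hb : 0 < b) (e : Fin m → ℝ)
    (c d : ℝ) : localResidual x b (fun j => c + d * x j + e j) = localResidual x b e := by
  ext i
  rw [localResidual, localResidual, sInf_localLevels_affine x hb]
  ring

theorem boundaryResidual_eq_localResidual (n : ℕ) (x Y : ℕ → ℝ) (b : ℝ) :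
    boundaryResidual n x Y b = localResidual (fun j : Fin (n / 2) => x (2 * ((j : ℕ) + 1))) b
      (fun j => Y (2 * ((j : ℕ) + 1))) := by
  ext i
  rw [boundaryResidual, localResidual, boundaryEstimator]
  congr 2
  ext p
  simp only [upperLevels, localLevels, Set.mem_ofPred_eq]
  refine exists_congr fun p₁ => ⟨fun h j hj => h _ ?_ hj, fun h j hj hj' => ?_⟩
  · have := j.2
    simp only [Finset.mem_Icc]
    omega
  · rw [Finset.mem_Icc] at hj
    have := h ⟨j - 1, by omega⟩
    simp only [Nat.sub_add_cancel hj.1] at this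
    exact this hj'

theorem measurable_localResidual {m : ℕ} (x : Fin m → ℝ) {b : ℝ} (hb : 0 < b) :
    Measurable (localResidual x b) := by
  refine measurable_pi_lambda _ fun i => (measurable_pi_apply i).sub ?_
  refine (continuous_of_monotone_of_add_const (fun v w hvw => ?_) fun v c => ?_).measurable
  · refine csInf_le_csInf (localLevels_bddBelow x hb v i) (localLevels_nonempty x b w i) ?_
    rintro p ⟨p₁, h⟩
    exact ⟨p₁, fun j hj => (hvw j).trans (h j hj)⟩
  · have := sInf_localLevels_affine x hb v i c 0
    simpa [add_comm] using this

/-- The zero line dominates nonpositive errors, so the estimated boundary is at most `0`. -/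
theorem le_localResidual {m : ℕ} (x : Fin m → ℝ) {b : ℝ} (hb : 0 < b) {e : Fin m → ℝ}
    (he : ∀ j, e j ≤ 0) (i : Fin m) : e i ≤ localResidual x b e i := by
  have := csInf_le (localLevels_bddBelow x hb e i) (mem_localLevels_of_forall_le x b i he)
  rw [localResidual]
  linarith

theorem localResidual_nonpos {m : ℕ} (x : Fin m → ℝ) {b : ℝ} (hb : 0 < b) (e : Fin m → ℝ)
    (i : Fin m) : localResidual x b e i ≤ 0 := by
  have := le_csInf (localLevels_nonempty x b e i) fun _ hp => le_of_mem_localLevels hb hp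
  rw [localResidual]
  linarith

/-- Large observations on both sides of `x i` in the window bound the estimator from below. -/
theorem localResidual_le_of_two_sided {m : ℕ} {x : Fin m → ℝ} {b : ℝ} {e : Fin m → ℝ}
    {i j l : Fin m} {d : ℝ} (hj : x j ≤ x i) (hl : x i ≤ x l) (hjb : |x i - x j| < b)
    (hlb : |x i - x l| < b) (hej : -d ≤ e j) (hel : -d ≤ e l) :
    localResidual x b e i ≤ e i + d := by
  have : -d ≤ sInf (localLevels x b e i) := by
    refine le_csInf (localLevels_nonempty x b e i) ?_
    rintro p ⟨p₁, h⟩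
    have h1 := h j hjb
    have h2 := h l hlb
    -- A line of nonnegative slope is at least as high at `x i` as at the left point; for
    -- nonpositive slope the right point serves.
    rcases le_total 0 p₁ with hp | hp
    · nlinarith
    · nlinarith
  rw [localResidual]
  linarith

/-! ### Ranks inside cells -/

/-- Insert points in increasing order of `f`: the new maximum has rank equal to the new cardinality,
and old ranks can only grow. Ties enlarge ranks, hence an inequality. -/
theorem sum_inv_card_le_harmonic {ι : Type*} [DecidableEq ι] (f : ι → ℝ) (s : Finset ι) :
    ∑ i ∈ s, ((s.filter fun j => f j ≤ f i).card : ℝ)⁻¹ ≤ ((harmonic s.card : ℚ) : ℝ) := by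
  induction s using Finset.induction_on_max_value f with
  | empty => simp
  | insert a s ha hmax ih =>
    rw [Finset.sum_insert ha, Finset.card_insert_of_notMem ha, harmonic_succ]
    have h1 : ((insert a s).filter fun j => f j ≤ f a) = insert a s := by
      refine Finset.filter_true_of_mem fun j hj => ?_
      rcases Finset.mem_insert.1 hj with rfl | hj
      · exact le_rfl
      · exact hmax j hj
    rw [h1, Finset.card_insert_of_notMem ha, add_comm]
    push_cast
    refine add_le_add (le_trans (Finset.sum_le_sum fun i hi => ?_) ih) le_rfl
    have hpos : 0 < (s.filter fun j => f j ≤ f i).card :=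
      Finset.card_pos.2 ⟨i, Finset.mem_filter.2 ⟨hi, le_rfl⟩⟩
    refine inv_anti₀ (by exact_mod_cast hpos) ?_
    exact_mod_cast Finset.card_le_card
      (Finset.filter_subset_filter _ (Finset.subset_insert a s))

/-- The points to the left of `x i` (inclusive) in the cell of length `b` that contains `x i`. -/
noncomputable def leftInCell {m : ℕ} (x : Fin m → ℝ) (b : ℝ) (i : Fin m) : Finset (Fin m) :=
  Finset.univ.filter fun j => ⌊x j / b⌋ = ⌊x i / b⌋ ∧ x j ≤ x i

/-- The points to the right of `x i` (inclusive) in the cell of length `b` that contains `x i`. -/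
noncomputable def rightInCell {m : ℕ} (x : Fin m → ℝ) (b : ℝ) (i : Fin m) : Finset (Fin m) :=
  Finset.univ.filter fun j => ⌊x j / b⌋ = ⌊x i / b⌋ ∧ x i ≤ x j

theorem mem_leftInCell_self {m : ℕ} (x : Fin m → ℝ) (b : ℝ) (i : Fin m) : i ∈ leftInCell x b i := by
  simp [leftInCell]

theorem mem_rightInCell_self {m : ℕ} (x : Fin m → ℝ) (b : ℝ) (i : Fin m) :
    i ∈ rightInCell x b i := by
  simp [rightInCell]

theorem abs_sub_lt_of_floor_div_eq {b s t : ℝ} (hb : 0 < b) (h : ⌊s / b⌋ = ⌊t / b⌋) :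
    |t - s| < b := by
  have := Int.abs_sub_lt_one_of_floor_eq_floor h.symm
  rwa [← sub_div, abs_div, abs_of_pos hb, div_lt_one hb] at this

theorem sum_inv_rank_in_cell_le {m : ℕ} (f : Fin m → ℝ) (c : Fin m → ℤ) {lo hi : ℤ}
    (hc : ∀ i, c i ∈ Finset.Icc lo hi) :
    ∑ i, (((Finset.univ.filter fun j => c j = c i ∧ f j ≤ f i).card : ℝ))⁻¹
      ≤ ((Finset.Icc lo hi).card : ℝ) * (1 + Real.log m) := by
  rw [← Finset.sum_fiberwise_of_maps_to (s := Finset.univ) (t := Finset.Icc lo hi) (g := c)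
    fun i _ => hc i, ← nsmul_eq_mul]
  refine Finset.sum_le_card_nsmul _ _ _ fun z _ => ?_
  have h1 := sum_inv_card_le_harmonic f (Finset.univ.filter fun i => c i = z)
  refine le_trans (le_of_eq (Finset.sum_congr rfl fun i hi => ?_)) (h1.trans ?_)
  · rw [Finset.filter_filter, (Finset.mem_filter.1 hi).2]
  · refine (harmonic_le_one_add_log _).trans ?_
    have hcard : (Finset.univ.filter fun i => c i = z).card ≤ m := by
      simpa using Finset.card_le_univ (Finset.univ.filter fun i => c i = z)
    -- For an empty cell `Real.log 0 = 0`, so monotonicity of the logarithm is not available and the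
    -- bound is checked directly.
    rcases Nat.eq_zero_or_pos (Finset.univ.filter fun i => c i = z).card with h0 | h0
    · rw [h0]
      have := Real.log_natCast_nonneg m
      simpa using this
    · have : Real.log ((Finset.univ.filter fun i => c i = z).card : ℝ) ≤ Real.log m :=
        Real.log_le_log (by exact_mod_cast h0) (by exact_mod_cast hcard)
      linarith

theorem card_floor_range_le {M b : ℝ} (hM : 0 ≤ M) (hb : 0 < b) :
    ((Finset.Icc ⌊-M / b⌋ ⌊M / b⌋).card : ℝ) ≤ 2 * M / b + 2 := by
  rw [Int.card_Icc]
  have h1 : ⌊-M / b⌋ ≤ ⌊M / b⌋ := Int.floor_le_floor (by gcongr; linarith)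
  have h2 : (((⌊M / b⌋ + 1 - ⌊-M / b⌋).toNat : ℤ) : ℝ) = ((⌊M / b⌋ + 1 - ⌊-M / b⌋ : ℤ) : ℝ) := by
    rw [Int.toNat_of_nonneg (by omega)]
  have h3 := Int.floor_le (M / b)
  have h4 := Int.lt_floor_add_one (-M / b)
  push_cast at h2
  rw [h2]
  have : 2 * M / b = M / b - (-M / b) := by ring
  linarith

theorem floor_div_mem_Icc {M b t : ℝ} (hb : 0 < b) (ht : |t| ≤ M) :
    ⌊t / b⌋ ∈ Finset.Icc ⌊-M / b⌋ ⌊M / b⌋ := by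
  obtain ⟨h1, h2⟩ := abs_le.1 ht
  exact Finset.mem_Icc.2 ⟨Int.floor_le_floor (by gcongr), Int.floor_le_floor (by gcongr)⟩

/-- Each cell contributes a harmonic sum for the left ranks and, after reflecting `x` to `-x`,
another for the right ranks. No regularity of the design inside the cells enters. -/
theorem sum_inv_card_inCell_le {m : ℕ} {x : Fin m → ℝ} {M b : ℝ} (hM : 0 ≤ M) (hb : 0 < b)
    (hx : ∀ i, |x i| ≤ M) :
    ∑ i, (((leftInCell x b i).card : ℝ)⁻¹ + ((rightInCell x b i).card : ℝ)⁻¹)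
      ≤ 2 * ((2 * M / b + 2) * (1 + Real.log m)) := by
  have hlog := Real.log_natCast_nonneg m
  have hc : ∀ i, ⌊x i / b⌋ ∈ Finset.Icc ⌊-M / b⌋ ⌊M / b⌋ := fun i => floor_div_mem_Icc hb (hx i)
  have h1 := sum_inv_rank_in_cell_le x (fun i => ⌊x i / b⌋) hc
  have h2 := sum_inv_rank_in_cell_le (fun i => -x i) (fun i => ⌊x i / b⌋) hc
  have h3 := mul_le_mul_of_nonneg_right (card_floor_range_le hM hb)
    (by linarith : 0 ≤ 1 + Real.log m)
  simp only [neg_le_neg_iff] at h2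
  rw [Finset.sum_add_distrib]
  simp only [leftInCell, rightInCell]
  linarith

/-! ### Independent coordinates -/

theorem measureReal_pi_forall_mem {ι : Type*} [Fintype ι] [DecidableEq ι] (μ : Measure ℝ)
    [IsProbabilityMeasure μ] (s : Finset ι) (B : Set ℝ) :
    (Measure.pi fun _ : ι => μ).real {e | ∀ i ∈ s, e i ∈ B} = μ.real B ^ s.card := by
  have h : {e : ι → ℝ | ∀ i ∈ s, e i ∈ B} = Set.univ.pi fun i => if i ∈ s then B else Set.univ := by
    ext e
    simp only [Set.mem_ofPred_eq, Set.mem_univ_pi]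
    refine forall_congr' fun i => ?_
    by_cases hi : i ∈ s <;> simp [hi]
  have h2 : (∏ i, μ (if i ∈ s then B else Set.univ)) = μ B ^ s.card := by
    have : ∀ i, μ (if i ∈ s then B else Set.univ) = if i ∈ s then μ B else 1 := fun i => by
      split_ifs <;> simp
    simp only [this, Finset.prod_ite_mem, Finset.univ_inter, Finset.prod_const]
  rw [measureReal_def, h, Measure.pi_pi, h2, ENNReal.toReal_pow, measureReal_def]

open Classical in
/-- The number of coordinates `e i` that lie in their sets `B i`. -/
noncomputable def hitCount {ι : Type*} [Fintype ι] (B : ι → Set ℝ) (e : ι → ℝ) : ℕ :=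
  (Finset.univ.filter fun i => e i ∈ B i).card

/-! ### Chernoff bounds for counts of independent events -/

theorem exp_mul_hitCount {ι : Type*} [Fintype ι] (B : ι → Set ℝ) (θ : ℝ) (e : ι → ℝ) :
    Real.exp (θ * hitCount B e)
      = ∏ i, (1 + (B i).indicator (fun _ => Real.exp θ - 1) (e i)) := by
  classical
  rw [hitCount, mul_comm, Real.exp_nat_mul, ← Finset.prod_const, Finset.prod_filter]
  refine Finset.prod_congr rfl fun i _ => ?_
  by_cases hi : e i ∈ B i <;> simp [hi]

theorem integrable_one_add_indicator (μ : Measure ℝ) [IsProbabilityMeasure μ] {B : Set ℝ}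
    (hB : MeasurableSet B) (c : ℝ) : Integrable (fun z => 1 + B.indicator (fun _ => c) z) μ :=
  (integrable_const _).add ((integrable_const _).indicator hB)

theorem integrable_exp_mul_hitCount {ι : Type*} [Fintype ι] (μ : Measure ℝ)
    [IsProbabilityMeasure μ] {B : ι → Set ℝ} (hB : ∀ i, MeasurableSet (B i)) (θ : ℝ) :
    Integrable (fun e => Real.exp (θ * hitCount B e)) (Measure.pi fun _ : ι => μ) := by
  simp only [exp_mul_hitCount]
  exact Integrable.fintype_prod fun i => integrable_one_add_indicator μ (hB i) _

/-- The exponential is a product of independent factors with means `1 + (exp θ - 1) p`, and `exp θ -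
1 ≤ θ + θ²` for `|θ| ≤ 1`. One bound serves both tails. -/
theorem mgf_hitCount_le {ι : Type*} [Fintype ι] (μ : Measure ℝ) [IsProbabilityMeasure μ]
    {B : ι → Set ℝ} (hB : ∀ i, MeasurableSet (B i)) {θ : ℝ} (hθ : |θ| ≤ 1) :
    mgf (fun e => (hitCount B e : ℝ)) (Measure.pi fun _ : ι => μ) θ
      ≤ Real.exp ((θ + θ ^ 2) * ∑ i, μ.real (B i)) := by
  simp only [mgf, exp_mul_hitCount]
  rw [integral_fintype_prod_eq_prod (fun i z => 1 + (B i).indicator (fun _ => Real.exp θ - 1) z),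
    Finset.mul_sum, Real.exp_sum]
  have hval : ∀ i, ∫ z, 1 + (B i).indicator (fun _ => Real.exp θ - 1) z ∂μ
      = 1 + (Real.exp θ - 1) * μ.real (B i) := fun i => by
    rw [integral_add (integrable_const _) ((integrable_const _).indicator (hB i)),
      integral_indicator_const _ (hB i)]
    simp [mul_comm]
  have hexp := (abs_le.1 (Real.abs_exp_sub_one_sub_id_le hθ)).2
  refine Finset.prod_le_prod (fun i _ => ?_) fun i _ => ?_
  · refine integral_nonneg fun z => ?_
    by_cases hz : z ∈ B i <;> simp [hz, Real.exp_nonneg]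
  · rw [hval]
    have h0 : 0 ≤ μ.real (B i) := measureReal_nonneg
    have := Real.add_one_le_exp ((θ + θ ^ 2) * μ.real (B i))
    nlinarith

/-- Chernoff's bound at the unoptimized parameter `-a / 4`; the exponent is at most `-(3 - a) a² k /
16`, and `a ≤ 1` gives the constant `1 / 8`. -/
theorem measureReal_hitCount_le_le {ι : Type*} [Fintype ι] (μ : Measure ℝ)
    [IsProbabilityMeasure μ] {B : ι → Set ℝ} (hB : ∀ i, MeasurableSet (B i)) {k a : ℝ}
    (hk : 0 ≤ k) (ha : 0 ≤ a) (ha1 : a ≤ 1) (h : k * (1 + a) ≤ ∑ i, μ.real (B i)) :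
    (Measure.pi fun _ : ι => μ).real {e | (hitCount B e : ℝ) ≤ k}
      ≤ Real.exp (-(a ^ 2 * k / 8)) := by
  have h1 := measure_le_le_exp_mul_mgf (X := fun e => (hitCount B e : ℝ))
    (μ := Measure.pi fun _ : ι => μ) (t := -(a / 4)) k (by linarith)
    (integrable_exp_mul_hitCount μ hB _)
  refine h1.trans ((mul_le_mul_of_nonneg_left (mgf_hitCount_le μ hB
    (by rw [abs_neg, abs_of_nonneg] <;> linarith)) (Real.exp_nonneg _)).trans ?_)
  rw [← Real.exp_add, Real.exp_le_exp]
  have h2 := mul_le_mul_of_nonneg_left h (by nlinarith : 0 ≤ a / 4 - (a / 4) ^ 2)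
  have h3 : 0 ≤ a ^ 2 * k * (1 - a) := mul_nonneg (by positivity) (by linarith)
  nlinarith [mul_nonneg (mul_nonneg ha ha) hk]

theorem measureReal_le_hitCount_le {ι : Type*} [Fintype ι] (μ : Measure ℝ)
    [IsProbabilityMeasure μ] {B : ι → Set ℝ} (hB : ∀ i, MeasurableSet (B i)) {k a : ℝ}
    (hk : 0 ≤ k) (ha : 0 ≤ a) (ha1 : a ≤ 1) (h : ∑ i, μ.real (B i) ≤ k * (1 - a)) :
    (Measure.pi fun _ : ι => μ).real {e | k ≤ (hitCount B e : ℝ)}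
      ≤ Real.exp (-(a ^ 2 * k / 8)) := by
  have h1 := measure_ge_le_exp_mul_mgf (X := fun e => (hitCount B e : ℝ))
    (μ := Measure.pi fun _ : ι => μ) (t := a / 4) k (by linarith)
    (integrable_exp_mul_hitCount μ hB _)
  refine h1.trans ((mul_le_mul_of_nonneg_left (mgf_hitCount_le μ hB
    (by rw [abs_of_nonneg] <;> linarith)) (Real.exp_nonneg _)).trans ?_)
  rw [← Real.exp_add, Real.exp_le_exp]
  have h2 := mul_le_mul_of_nonneg_left h (by positivity : 0 ≤ a / 4 + (a / 4) ^ 2)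
  have h3 : 0 ≤ a ^ 2 * k * a := by positivity
  nlinarith [mul_nonneg (mul_nonneg ha ha) hk]

/-! ### Moments of order statistics -/

/-- Layer-cake formula, split at `1`: near `0` the probability is at most `1` and `p > 0` suffices;
at infinity the tail bound and `p < Γ` do. -/
theorem integrable_abs_rpow_of_cdf_le {μ : Measure ℝ} [IsProbabilityMeasure μ]
    (hneg : ∀ᵐ z ∂μ, z < 0) {Γ C : ℝ} (htail : ∀ t < 0, cdf μ t ≤ C * |t| ^ (-Γ)) {p : ℝ}
    (hp : 0 < p) (hpΓ : p < Γ) : Integrable (fun z => |z| ^ p) μ := by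
  have hmeas : Measurable fun z : ℝ => |z| ^ p := by fun_prop
  refine ⟨hmeas.aestronglyMeasurable, ?_⟩
  rw [hasFiniteIntegral_iff_ofReal (Eventually.of_forall fun z => by positivity)]
  have habs : ∫⁻ z, ENNReal.ofReal (|z| ^ p) ∂μ = ∫⁻ z, ENNReal.ofReal ((-z) ^ p) ∂μ :=
    lintegral_congr_ae (hneg.mono fun z hz => by simp only [abs_of_neg hz])
  rw [habs, lintegral_rpow_eq_lintegral_meas_le_mul μ (f := fun z => -z)
    (hneg.mono fun z hz => by simpa using hz.le) measurable_neg.aemeasurable hp]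
  refine ENNReal.mul_lt_top ENNReal.ofReal_lt_top ?_
  have hset : ∀ t : ℝ, μ {a | t ≤ -a} = ENNReal.ofReal (cdf μ (-t)) := fun t => by
    rw [cdf_eq_real, measureReal_def, ENNReal.ofReal_toReal (measure_ne_top _ _)]
    congr 1
    ext a
    simp [le_neg]
  have hI1 : IntegrableOn (fun t : ℝ => t ^ (p - 1)) (Set.Ioc 0 1) :=
    (intervalIntegrable_iff_integrableOn_Ioc_of_le zero_le_one).1
      (intervalIntegral.intervalIntegrable_rpow' (by linarith))
  have hI2 : IntegrableOn (fun t : ℝ => C * t ^ (p - 1 - Γ)) (Set.Ioi 1) :=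
    (integrableOn_Ioi_rpow_of_lt (by linarith) zero_lt_one).const_mul C
  rw [← Set.Ioc_union_Ioi_eq_Ioi (zero_le_one' ℝ)]
  refine (lintegral_union_le _ _ _).trans_lt (ENNReal.add_lt_top.2 ⟨?_, ?_⟩)
  · refine lt_of_le_of_lt (setLIntegral_mono' measurableSet_Ioc
      (g := fun t => ENNReal.ofReal (t ^ (p - 1))) fun t ht => ?_) hI1.lintegral_lt_top
    exact mul_le_of_le_one_left' prob_le_one
  · refine lt_of_le_of_lt (setLIntegral_mono' measurableSet_Ioi
      (g := fun t => ENNReal.ofReal (C * t ^ (p - 1 - Γ))) fun t ht => ?_) hI2.lintegral_lt_top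
    have ht0 : (0 : ℝ) < t := zero_lt_one.trans ht
    rw [hset, ← ENNReal.ofReal_mul (cdf_nonneg _ _)]
    refine ENNReal.ofReal_le_ofReal ?_
    have := mul_le_mul_of_nonneg_right (htail (-t) (by linarith)) (Real.rpow_nonneg ht0.le (p - 1))
    rwa [abs_neg, abs_of_pos ht0, mul_assoc, ← Real.rpow_add ht0,
      show -Γ + (p - 1) = p - 1 - Γ by ring] at this

/-! ### Block bound for moments of order statistics -/

theorem card_filter_div_eq {m q a : ℕ} (hq : 0 < q) (h : (a + 1) * q ≤ m) :
    (Finset.univ.filter fun i : Fin m => (i : ℕ) / q = a).card = q := by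
  have : (Finset.univ.filter fun i : Fin m => (i : ℕ) / q = a).card
      = (Finset.Ico (a * q) ((a + 1) * q)).card := by
    refine Finset.card_bij (fun i _ => (i : ℕ)) (fun i hi => ?_) (fun i _ j _ hij => Fin.ext hij)
      fun i hi => ?_
    · have := (Nat.div_eq_iff hq).1 (Finset.mem_filter.1 hi).2
      rw [Finset.mem_Ico, add_mul, one_mul]
      omega
    · have := Finset.mem_Ico.1 hi
      refine ⟨⟨i, this.2.trans_le h⟩, ?_, rfl⟩
      rw [Finset.mem_filter, Nat.div_eq_iff hq]
      rw [add_mul, one_mul] at this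
      refine ⟨Finset.mem_univ _, ?_⟩
      change _ ≤ i ∧ i ≤ _
      omega
  rw [this, Nat.card_Ico, add_mul]
  omega

/-- If the index set is cut into blocks of length `q`, then one of the first `k + 1` blocks lies
completely below the order statistic of rank `m - k`. -/
theorem neg_orderStat_pow_le {m k q : ℕ} (hq : 0 < q) (hkm : (k + 1) * q ≤ m) (hk : k < m)
    {e : Fin m → ℝ} (he : ∀ i, e i ≤ 0) (r : ℕ) :
    (-orderStat e (m - k)) ^ r ≤ ∑ a ∈ Finset.range (k + 1), ∏ i : Fin m,
      if (i : ℕ) / q = a then |e i| ^ ((r : ℝ) / q) else 1 := by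
  have hv : 0 ≤ -orderStat e (m - k) :=
    neg_nonneg.2 (orderStat_le_of_forall (by omega) (by omega) e he)
  have : Nonempty (Fin m) := ⟨⟨0, by omega⟩⟩
  -- Pigeonhole: otherwise each of the `k + 1` disjoint blocks would contain a value above the order
  -- statistic of rank `m - k`, but at most `k` values lie above it.
  obtain ⟨a, ha, hblock⟩ : ∃ a ∈ Finset.range (k + 1), ∀ i : Fin m, (i : ℕ) / q = a →
      e i ≤ orderStat e (m - k) := by
    by_contra! hcon
    choose! f hf1 hf2 using hcon
    have h1 := (orderStat_le_iff e (j := m - k) (by omega) (by omega) _).1 le_rfl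
    have h2 := Finset.card_filter_add_card_filter_not (s := (Finset.univ : Finset (Fin m)))
      (fun i => e i ≤ orderStat e (m - k))
    have h3 : (Finset.range (k + 1)).card ≤
        (Finset.univ.filter fun i => ¬ e i ≤ orderStat e (m - k)).card := by
      refine Finset.card_le_card_of_injOn f (fun a ha => ?_) fun a ha b hb hab => ?_
      · simpa using hf2 a ha
      · rw [← hf1 a ha, ← hf1 b hb, hab]
    simp only [Finset.card_univ, Fintype.card_fin, Finset.card_range] at h2 h3
    omega
  refine le_trans ?_ (Finset.single_le_sum (f := fun a => ∏ i : Fin m,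
      if (i : ℕ) / q = a then |e i| ^ ((r : ℝ) / q) else 1)
    (fun a _ => Finset.prod_nonneg fun i _ => by split_ifs <;> positivity) ha)
  have hcard := card_filter_div_eq (m := m) hq
    ((Nat.mul_le_mul_right q (Nat.succ_le_iff.2 (Finset.mem_range.1 ha))).trans hkm)
  -- The power `r` is shared among the `q` independent entries of the block, so only a moment of
  -- order `r / q` is needed.
  have hpow : (-orderStat e (m - k)) ^ r = ((-orderStat e (m - k)) ^ ((r : ℝ) / q)) ^ q := by
    rw [← Real.rpow_natCast _ q, ← Real.rpow_mul hv, div_mul_cancel₀ _ (by positivity),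
      Real.rpow_natCast]
  have hprod : ((-orderStat e (m - k)) ^ ((r : ℝ) / q)) ^ q
      = ∏ _i ∈ Finset.univ.filter fun i : Fin m => (i : ℕ) / q = a,
        (-orderStat e (m - k)) ^ ((r : ℝ) / q) := by
    rw [Finset.prod_const, hcard]
  rw [hpow, ← Finset.prod_filter, hprod]
  refine Finset.prod_le_prod (fun i _ => by positivity) fun i hi => ?_
  refine Real.rpow_le_rpow hv ?_ (by positivity)
  rw [abs_of_nonpos (he i)]
  exact neg_le_neg (hblock i (Finset.mem_filter.1 hi).2)

theorem integrable_block_prod {m : ℕ} {μ : Measure ℝ} [IsProbabilityMeasure μ] {p : ℝ}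
    (hμ : Integrable (fun z => |z| ^ p) μ) (q a : ℕ) :
    Integrable (fun e : Fin m → ℝ => ∏ i : Fin m, if (i : ℕ) / q = a then |e i| ^ p else 1)
      (Measure.pi fun _ => μ) := by
  refine Integrable.fintype_prod
    (f := fun (i : Fin m) z => if (i : ℕ) / q = a then |z| ^ p else (1 : ℝ)) fun i => ?_
  split_ifs
  · exact hμ
  · exact integrable_const _

theorem integral_block_prod {m : ℕ} {μ : Measure ℝ} [IsProbabilityMeasure μ] {p : ℝ}
    {q a : ℕ} (hq : 0 < q) (h : (a + 1) * q ≤ m) :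
    ∫ e : Fin m → ℝ, (∏ i : Fin m, if (i : ℕ) / q = a then |e i| ^ p else 1)
      ∂(Measure.pi fun _ => μ) = (∫ z, |z| ^ p ∂μ) ^ q := by
  rw [integral_fintype_prod_eq_prod
    (fun (i : Fin m) z => if (i : ℕ) / q = a then |z| ^ p else (1 : ℝ))]
  have : ∀ i : Fin m, ∫ z, (if (i : ℕ) / q = a then |z| ^ p else (1 : ℝ)) ∂μ
      = if (i : ℕ) / q = a then ∫ z, |z| ^ p ∂μ else 1 := fun i => by
    split_ifs <;> simp
  simp only [this]
  rw [← Finset.prod_filter, Finset.prod_const, card_filter_div_eq hq h]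

/-! ### A high-probability event on which the spacing of residuals is controlled -/

/-- The radius attached to `x i`: inversely proportional to the ranks of `x i` in its cell. -/
noncomputable def cellRadius {m : ℕ} (x : Fin m → ℝ) (b w : ℝ) (i : Fin m) : ℝ :=
  w * (((leftInCell x b i).card : ℝ)⁻¹ + ((rightInCell x b i).card : ℝ)⁻¹)

open Classical in
/-- The values of the error `e i` for which the residual can exceed `-s`. -/
noncomputable def exceedSet {m : ℕ} (x : Fin m → ℝ) (b w z₀ s : ℝ) (i : Fin m) : Set ℝ :=
  if cellRadius x b w i ≤ z₀ then Set.Ioi (-(s + cellRadius x b w i)) else Set.univ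

/-- Every sufficiently large set `A i` contains a point with error above `-w / #(A i)`. -/
def wellFilled {m : ℕ} (A : Fin m → Finset (Fin m)) (w z₀ : ℝ) : Set (Fin m → ℝ) :=
  {e | ∀ i, w * ((A i).card : ℝ)⁻¹ ≤ z₀ → ∃ j ∈ A i, -(w * ((A i).card : ℝ)⁻¹) < e j}

/-- The event on which the spacing of the residuals lies between `s₂ - τ` and `s₁`. -/
def goodEvent {m : ℕ} (x : Fin m → ℝ) (b : ℝ) (k : ℕ) (s₁ s₂ τ w z₀ : ℝ) : Set (Fin m → ℝ) :=
  {e | k < hitCount (fun _ => Set.Ioi (-s₁)) e ∧ hitCount (exceedSet x b w z₀ s₂) e ≤ k ∧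
    (∃ i, -τ < e i) ∧ e ∈ wellFilled (leftInCell x b) w z₀ ∧ e ∈ wellFilled (rightInCell x b) w z₀}

/-- The spacing between the largest residual and the one of rank `m - k`. -/
noncomputable def residualSpacing {m : ℕ} (x : Fin m → ℝ) (b : ℝ) (k : ℕ) (e : Fin m → ℝ) : ℝ :=
  orderStat (localResidual x b e) m - orderStat (localResidual x b e) (m - k)

theorem measurable_residualSpacing {m k : ℕ} (x : Fin m → ℝ) {b : ℝ} (hb : 0 < b) (hk : k < m) :
    Measurable (residualSpacing x b k) :=
  ((measurable_orderStat (by omega) le_rfl).comp (measurable_localResidual x hb)).sub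
    ((measurable_orderStat (by omega) (by omega)).comp (measurable_localResidual x hb))

theorem residualSpacing_nonneg {m k : ℕ} (x : Fin m → ℝ) (b : ℝ) (hk : k < m) (e : Fin m → ℝ) :
    0 ≤ residualSpacing x b k e :=
  sub_nonneg.2 (orderStat_mono_rank (by omega) (by omega) le_rfl _)

theorem residualSpacing_le {m k : ℕ} (x : Fin m → ℝ) {b : ℝ} (hb : 0 < b) (hk : k < m)
    {e : Fin m → ℝ} (he : ∀ i, e i ≤ 0) : residualSpacing x b k e ≤ -orderStat e (m - k) := by
  have h1 := orderStat_le_of_forall (by omega : 1 ≤ m) le_rfl _ (localResidual_nonpos x hb e)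
  have h2 := orderStat_monotone (m := m) (j := m - k) (by omega) (by omega)
    (le_localResidual x hb he : e ≤ localResidual x b e)
  simp only at h2
  rw [residualSpacing]
  linarith

theorem residualSpacing_le_of_mem_goodEvent {m k : ℕ} (x : Fin m → ℝ) {b : ℝ} (hb : 0 < b)
    (hk : k < m) {s₁ s₂ τ w z₀ : ℝ} {e : Fin m → ℝ} (he : ∀ i, e i ≤ 0)
    (hgood : e ∈ goodEvent x b k s₁ s₂ τ w z₀) : residualSpacing x b k e ≤ s₁ := by
  have h1 := residualSpacing_le x hb hk he
  have h2 : -s₁ ≤ orderStat e (m - k) := by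
    refine le_orderStat_of_lt_card hk e ?_
    have := hgood.1
    simp only [hitCount, Set.mem_Ioi] at this
    convert this
  linarith

/-- Well-filledness supplies, on either side of `x i` in its cell, an error above minus the radius;
a cell has length `b`, so both points lie in the window. -/
theorem localResidual_le_add_cellRadius {m k : ℕ} {x : Fin m → ℝ} {b : ℝ} (hb : 0 < b)
    {s₁ s₂ τ w z₀ : ℝ} (hw : 0 ≤ w) {e : Fin m → ℝ} (hgood : e ∈ goodEvent x b k s₁ s₂ τ w z₀)
    {i : Fin m} (hi : cellRadius x b w i ≤ z₀) :
    localResidual x b e i ≤ e i + cellRadius x b w i := by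
  obtain ⟨-, -, -, hl, hr⟩ := hgood
  have h1 : w * ((leftInCell x b i).card : ℝ)⁻¹ ≤ cellRadius x b w i := by
    rw [cellRadius, mul_add]
    exact le_add_of_nonneg_right (by positivity)
  have h2 : w * ((rightInCell x b i).card : ℝ)⁻¹ ≤ cellRadius x b w i := by
    rw [cellRadius, mul_add]
    exact le_add_of_nonneg_left (by positivity)
  obtain ⟨j, hj, hej⟩ := hl i (h1.trans hi)
  obtain ⟨l, hl', hel⟩ := hr i (h2.trans hi)
  simp only [leftInCell, rightInCell, Finset.mem_filter, Finset.mem_univ, true_and] at hj hl'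
  exact localResidual_le_of_two_sided hj.2 hl'.2 (abs_sub_lt_of_floor_div_eq hb hj.1)
    (abs_sub_lt_of_floor_div_eq hb hl'.1) (by linarith) (by linarith)

/-- The largest residual dominates an error above `-τ`, and a residual above `-s₂` forces its error
into `exceedSet`, which happens at most `k` times. -/
theorem le_residualSpacing_of_mem_goodEvent {m k : ℕ} (x : Fin m → ℝ) {b : ℝ} (hb : 0 < b)
    (hk : k < m) {s₁ s₂ τ w z₀ : ℝ} (hw : 0 ≤ w) {e : Fin m → ℝ} (he : ∀ i, e i ≤ 0)
    (hgood : e ∈ goodEvent x b k s₁ s₂ τ w z₀) : s₂ - τ ≤ residualSpacing x b k e := by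
  obtain ⟨i, hi⟩ := hgood.2.2.1
  have h1 : -τ ≤ orderStat (localResidual x b e) m :=
    hi.le.trans ((le_localResidual x hb he i).trans (le_orderStat_last _ i))
  have h2 : orderStat (localResidual x b e) (m - k) ≤ -s₂ := by
    refine orderStat_le_of_card_le hk _ (le_trans (Finset.card_le_card fun j hj => ?_) hgood.2.1)
    simp only [Finset.mem_filter, Finset.mem_univ, true_and] at hj ⊢
    rw [exceedSet]
    split_ifs with hr
    · have := localResidual_le_add_cellRadius hb hw hgood hr
      rw [Set.mem_Ioi]
      linarith
    · trivial
  rw [residualSpacing]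
  linarith

theorem measurableSet_exceedSet {m : ℕ} (x : Fin m → ℝ) (b w z₀ s : ℝ) (i : Fin m) :
    MeasurableSet (exceedSet x b w z₀ s i) := by
  rw [exceedSet]
  split_ifs
  · exact measurableSet_Ioi
  · exact MeasurableSet.univ

theorem measureReal_pi_forall_le {m : ℕ} {μ : Measure ℝ} [IsProbabilityMeasure μ]
    {c z : ℝ} (hG : c ≤ μ.real (Set.Ioi (-z))) (s : Finset (Fin m)) :
    (Measure.pi fun _ : Fin m => μ).real {e | ∀ i ∈ s, e i ≤ -z} ≤ Real.exp (-(c * s.card)) := by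
  have h := measureReal_pi_forall_mem μ s (Set.Iic (-z))
  simp only [Set.mem_Iic] at h
  rw [h]
  have h1 : μ.real (Set.Iic (-z)) = 1 - μ.real (Set.Ioi (-z)) := by
    rw [← Set.compl_Ioi, probReal_compl_eq_one_sub measurableSet_Ioi]
  have h2 : μ.real (Set.Iic (-z)) ≤ Real.exp (-c) :=
    (by linarith : μ.real (Set.Iic (-z)) ≤ 1 - c).trans (Real.one_sub_le_exp_neg c)
  refine (pow_le_pow_left₀ measureReal_nonneg h2 _).trans ?_
  rw [← Real.exp_nat_mul]
  exact Real.exp_le_exp.2 (by linarith)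

/-- The threshold `w / #(A i)` makes the cardinality cancel: all errors of `A i` lie below it with
probability at most `exp(-γ w / 2)`, uniformly in `i`, and a union bound over `i` finishes. -/
theorem measureReal_wellFilled_compl_le {m : ℕ} {μ : Measure ℝ} [IsProbabilityMeasure μ]
    {γ z₀ w : ℝ} (hG : ∀ z, 0 < z → z ≤ z₀ → γ * z / 2 ≤ μ.real (Set.Ioi (-z))) (hw : 0 < w)
    {A : Fin m → Finset (Fin m)} (hA : ∀ i, i ∈ A i) :
    (Measure.pi fun _ : Fin m => μ).real (wellFilled A w z₀)ᶜ
      ≤ m * Real.exp (-(γ * w / 2)) := by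
  classical
  have hsub : (wellFilled A w z₀)ᶜ ⊆ ⋃ i, {e : Fin m → ℝ | w * ((A i).card : ℝ)⁻¹ ≤ z₀ ∧
      ∀ j ∈ A i, e j ≤ -(w * ((A i).card : ℝ)⁻¹)} := by
    intro e he
    simp only [wellFilled, Set.mem_compl_iff, Set.mem_ofPred_eq, not_forall, not_exists, not_and,
      not_lt] at he
    obtain ⟨i, hi, h⟩ := he
    exact Set.mem_iUnion.2 ⟨i, hi, h⟩
  refine (measureReal_mono hsub).trans ((measureReal_iUnion_fintype_le _).trans ?_)
  refine le_trans (Finset.sum_le_card_nsmul _ _ (Real.exp (-(γ * w / 2))) fun i _ => ?_)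
    (by simp)
  by_cases hi : w * ((A i).card : ℝ)⁻¹ ≤ z₀
  · have hpos : 0 < ((A i).card : ℝ) := by exact_mod_cast Finset.card_pos.2 ⟨i, hA i⟩
    simp only [hi, true_and]
    refine (measureReal_pi_forall_le (hG _ (by positivity) hi) (A i)).trans
      (Real.exp_le_exp.2 (le_of_eq ?_))
    field_simp
  · simp only [hi, false_and, Set.ofPred_false, measureReal_empty]
    positivity

theorem measureReal_goodEvent_compl_le {m k : ℕ} (x : Fin m → ℝ) (b : ℝ) {μ : Measure ℝ}
    [IsProbabilityMeasure μ] {γ s₁ s₂ τ w z₀ a : ℝ}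
    (hG : ∀ z, 0 < z → z ≤ z₀ → γ * z / 2 ≤ μ.real (Set.Ioi (-z))) (hw : 0 < w)
    (ha : 0 ≤ a) (ha1 : a ≤ 1) (hτ : 0 < τ) (hτz : τ ≤ z₀)
    (hs₁ : k * (1 + a) ≤ m * μ.real (Set.Ioi (-s₁)))
    (hs₂ : ∑ i, μ.real (exceedSet x b w z₀ s₂ i) ≤ k * (1 - a)) :
    (Measure.pi fun _ : Fin m => μ).real (goodEvent x b k s₁ s₂ τ w z₀)ᶜ
      ≤ 2 * Real.exp (-(a ^ 2 * k / 8)) + Real.exp (-(γ * τ / 2 * m))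
        + 2 * (m * Real.exp (-(γ * w / 2))) := by
  have h1 := measureReal_hitCount_le_le μ (B := fun _ : Fin m => Set.Ioi (-s₁))
    (fun _ => measurableSet_Ioi) (k := k) (a := a) (by positivity) ha ha1 (by simpa using hs₁)
  have h2 := measureReal_le_hitCount_le μ (measurableSet_exceedSet x b w z₀ s₂) (k := k) (a := a)
    (by positivity) ha ha1 hs₂
  have h3 := measureReal_pi_forall_le (hG τ hτ hτz) (Finset.univ : Finset (Fin m))
  have h4 := measureReal_wellFilled_compl_le hG hw (mem_leftInCell_self x b)
  have h5 := measureReal_wellFilled_compl_le hG hw (mem_rightInCell_self x b)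
  have hsub : (goodEvent x b k s₁ s₂ τ w z₀)ᶜ ⊆
      (({e | (hitCount (fun _ : Fin m => Set.Ioi (-s₁)) e : ℝ) ≤ k} ∪
        {e | (k : ℝ) ≤ (hitCount (exceedSet x b w z₀ s₂) e : ℝ)}) ∪
        {e | ∀ i ∈ (Finset.univ : Finset (Fin m)), e i ≤ -τ}) ∪
        ((wellFilled (leftInCell x b) w z₀)ᶜ ∪ (wellFilled (rightInCell x b) w z₀)ᶜ) := by
    intro e he
    by_contra hcon
    simp only [Set.mem_union, not_or, Set.mem_compl_iff, not_not, Set.mem_ofPred_eq, not_le,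
      Nat.cast_lt, Finset.mem_univ, true_implies, not_forall] at hcon
    exact he ⟨hcon.1.1.1, hcon.1.1.2.le, hcon.1.2, hcon.2.1, hcon.2.2⟩
  simp only [Finset.card_univ, Fintype.card_fin] at h3
  refine (measureReal_mono hsub).trans ?_
  refine (measureReal_union_le _ _).trans ?_
  have u1 := measureReal_union_le (μ := Measure.pi fun _ : Fin m => μ)
    ({e | (hitCount (fun _ : Fin m => Set.Ioi (-s₁)) e : ℝ) ≤ k} ∪
        {e | (k : ℝ) ≤ (hitCount (exceedSet x b w z₀ s₂) e : ℝ)})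
    {e | ∀ i ∈ (Finset.univ : Finset (Fin m)), e i ≤ -τ}
  have u2 := measureReal_union_le (μ := Measure.pi fun _ : Fin m => μ)
    {e | (hitCount (fun _ : Fin m => Set.Ioi (-s₁)) e : ℝ) ≤ k}
    {e | (k : ℝ) ≤ (hitCount (exceedSet x b w z₀ s₂) e : ℝ)}
  have u3 := measureReal_union_le (μ := Measure.pi fun _ : Fin m => μ)
    (wellFilled (leftInCell x b) w z₀)ᶜ (wellFilled (rightInCell x b) w z₀)ᶜ
  linarith

theorem measureReal_exceedSet_le {m : ℕ} (x : Fin m → ℝ) (b : ℝ) {μ : Measure ℝ}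
    [IsProbabilityMeasure μ] {γ C s w z₀ : ℝ} (hγ : 0 ≤ γ) (hC : 0 ≤ C)
    (hG : ∀ z, 0 < z → μ.real (Set.Ioi (-z)) ≤ γ * z + C * z ^ 2) (hw : 0 ≤ w) (hs : 0 < s)
    (hz₀ : 0 < z₀) (hz₁ : z₀ ≤ 1) (i : Fin m) :
    μ.real (exceedSet x b w z₀ s i)
      ≤ γ * s + (γ + 2 * C + z₀⁻¹) * (cellRadius x b w i + s ^ 2) := by
  have hr : 0 ≤ cellRadius x b w i := by rw [cellRadius]; positivity
  rw [exceedSet]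
  generalize cellRadius x b w i = r at hr ⊢
  have hz : 0 ≤ z₀⁻¹ := by positivity
  split_ifs with h
  · have h1 := hG (s + r) (by linarith)
    have h2 : C * (s + r) ^ 2 ≤ C * (2 * (s ^ 2 + r)) :=
      mul_le_mul_of_nonneg_left (by nlinarith [sq_nonneg (s - r)]) hC
    have h3 : 0 ≤ (γ + z₀⁻¹) * s ^ 2 := by positivity
    have h4 : 0 ≤ z₀⁻¹ * r := by positivity
    nlinarith
  -- Where the radius is too large for the expansion of `F`, the trivial probability `1` is still at
  -- most `r / z₀`, so these points are also paid for by the sum of the radii.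
  · have h1 : 1 ≤ z₀⁻¹ * r := by
      rw [inv_mul_eq_div, le_div_iff₀ hz₀]
      linarith
    have h3 : 0 ≤ γ * s + (γ + 2 * C) * (r + s ^ 2) + z₀⁻¹ * s ^ 2 := by positivity
    rw [probReal_univ]
    nlinarith

/-! ### The fourth moment -/

theorem integral_pow_four_le {α : Type*} [MeasurableSpace α] {π : Measure α}
    [IsProbabilityMeasure π] {X U : α → ℝ} {s : Set α} {D lam : ℝ} (hX : AEStronglyMeasurable X π)
    (hU : Integrable U π) (hlam : 0 < lam) (hD : ∀ᵐ a ∂π, a ∈ s → |X a| ≤ D)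
    (hXU : ∀ᵐ a ∂π, X a ^ 8 ≤ U a) :
    Integrable (fun a => X a ^ 4) π ∧
      ∫ a, X a ^ 4 ∂π ≤ D ^ 4 + lam * ∫ a, U a ∂π + lam⁻¹ * π.real sᶜ := by
  -- The measurable hull has the same measure, so `s` need not be measurable.
  set t := toMeasurable π sᶜ
  have ht : MeasurableSet t := measurableSet_toMeasurable _ _
  have hdom : Integrable (fun a => D ^ 4 + lam * U a + lam⁻¹ * t.indicator (fun _ => (1 : ℝ)) a)
      π :=
    ((integrable_const _).add (hU.const_mul lam)).add
      (((integrable_const _).indicator ht).const_mul _)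
  have hle : ∀ᵐ a ∂π, X a ^ 4 ≤ D ^ 4 + lam * U a + lam⁻¹ * t.indicator (fun _ => (1 : ℝ)) a := by
    filter_upwards [hD, hXU] with a h1 h2
    have h8 : 0 ≤ X a ^ 8 := by positivity
    have h3 : 0 ≤ lam * U a := mul_nonneg hlam.le (h8.trans h2)
    by_cases ha : a ∈ s
    · have h4 : X a ^ 4 ≤ D ^ 4 := by
        rw [← Even.pow_abs (by decide : Even 4)]
        exact pow_le_pow_left₀ (abs_nonneg _) (h1 ha) 4
      have h5 : 0 ≤ lam⁻¹ * t.indicator (fun _ => (1 : ℝ)) a :=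
        mul_nonneg (by positivity) (Set.indicator_nonneg (fun _ _ => zero_le_one) _)
      linarith
    · have hat : a ∈ t := subset_toMeasurable _ _ ha
      have h4 : lam * X a ^ 8 ≤ lam * U a := mul_le_mul_of_nonneg_left h2 hlam.le
      -- Young's inequality in place of Cauchy–Schwarz, proved by completing the square in `X a ^
      -- 4`.
      have h5 : X a ^ 4 ≤ lam * X a ^ 8 + lam⁻¹ := by
        have h6 : lam * X a ^ 8 + lam⁻¹ - X a ^ 4
            = lam * ((X a ^ 4 - lam⁻¹ / 2) ^ 2 + 3 / 4 * lam⁻¹ ^ 2) := by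
          field_simp
          ring
        have h7 : 0 ≤ lam * ((X a ^ 4 - lam⁻¹ / 2) ^ 2 + 3 / 4 * lam⁻¹ ^ 2) := by positivity
        linarith
      rw [Set.indicator_of_mem hat]
      have h6 : 0 ≤ D ^ 4 := by positivity
      linarith
  refine ⟨hdom.mono' (hX.pow 4) (hle.mono fun a ha => ?_), ?_⟩
  · rwa [Real.norm_of_nonneg (by positivity)]
  · refine (integral_mono_of_nonneg (Eventually.of_forall fun a => by positivity) hdom hle).trans
      (le_of_eq ?_)
    have hind : Integrable (fun a => lam⁻¹ * t.indicator (fun _ => (1 : ℝ)) a) π :=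
      ((integrable_const _).indicator ht).const_mul _
    have hconst : Integrable (fun a => D ^ 4 + lam * U a) π :=
      (integrable_const _).add (hU.const_mul lam)
    rw [integral_add hconst hind, integral_add (integrable_const _)
      (hU.const_mul lam), integral_const_mul, integral_const_mul, integral_indicator_const _ ht]
    simp [t, measureReal_def, measure_toMeasurable]

theorem ae_pi_forall_le_zero {m : ℕ} {μ : Measure ℝ} [IsProbabilityMeasure μ]
    (hneg : ∀ᵐ z ∂μ, z < 0) : ∀ᵐ e ∂(Measure.pi fun _ : Fin m => μ), ∀ i, e i ≤ 0 := by
  rw [ae_all_iff]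
  intro i
  exact (measurePreserving_eval (fun _ : Fin m => μ) i).quasiMeasurePreserving.ae
    (hneg.mono fun _ h => h.le)

theorem integral_spacing_pow_four_le {m k q : ℕ} (x : Fin m → ℝ) {b : ℝ} (hb : 0 < b)
    {μ : Measure ℝ} [IsProbabilityMeasure μ] (hneg : ∀ᵐ z ∂μ, z < 0)
    (hq : 0 < q) (hkm : (k + 1) * q ≤ m) (hk0 : 0 < k) (hk : k < m)
    (hμ : Integrable (fun z => |z| ^ ((8 : ℕ) / q : ℝ)) μ)
    {γ s₁ s₂ τ w z₀ D lam : ℝ} (hγ : 0 < γ) (hw : 0 ≤ w) (hlam : 0 < lam)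
    (hD₁ : (m : ℝ) / k * s₁ - 1 / γ ≤ D) (hD₂ : -D ≤ (m : ℝ) / k * (s₂ - τ) - 1 / γ) :
    Integrable (fun e => ((m : ℝ) / k * residualSpacing x b k e - 1 / γ) ^ 4)
        (Measure.pi fun _ : Fin m => μ) ∧
      ∫ e, ((m : ℝ) / k * residualSpacing x b k e - 1 / γ) ^ 4 ∂(Measure.pi fun _ : Fin m => μ)
        ≤ D ^ 4 + lam * ((m : ℝ) ^ 9 * (∫ z, |z| ^ ((8 : ℕ) / q : ℝ) ∂μ) ^ q + (1 / γ) ^ 8)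
          + lam⁻¹ * (Measure.pi fun _ : Fin m => μ).real (goodEvent x b k s₁ s₂ τ w z₀)ᶜ := by
  have hmk : 0 ≤ (m : ℝ) / k := by positivity
  have hsum : Integrable (fun e : Fin m → ℝ => ∑ a ∈ Finset.range (k + 1), ∏ i : Fin m,
      if (i : ℕ) / q = a then |e i| ^ ((8 : ℕ) / q : ℝ) else 1) (Measure.pi fun _ => μ) :=
    integrable_finsetSum _ fun a _ => integrable_block_prod hμ q a
  have key := integral_pow_four_le (π := Measure.pi fun _ : Fin m => μ)
    (X := fun e => (m : ℝ) / k * residualSpacing x b k e - 1 / γ)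
    (U := fun e => ((m : ℝ) / k) ^ 8 * (∑ a ∈ Finset.range (k + 1), ∏ i : Fin m,
      if (i : ℕ) / q = a then |e i| ^ ((8 : ℕ) / q : ℝ) else 1) + (1 / γ) ^ 8)
    (s := goodEvent x b k s₁ s₂ τ w z₀) (D := D)
    (((measurable_residualSpacing x hb hk).const_mul _).sub_const _).aestronglyMeasurable
    ((hsum.const_mul _).add (integrable_const _)) hlam ?_ ?_
  · refine ⟨key.1, key.2.trans ?_⟩
    have hM : 0 ≤ (∫ z, |z| ^ ((8 : ℕ) / q : ℝ) ∂μ) ^ q :=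
      pow_nonneg (integral_nonneg fun z => by positivity) q
    have hint : ∫ e : Fin m → ℝ, (((m : ℝ) / k) ^ 8 * (∑ a ∈ Finset.range (k + 1), ∏ i : Fin m,
        if (i : ℕ) / q = a then |e i| ^ ((8 : ℕ) / q : ℝ) else 1) + (1 / γ) ^ 8)
          ∂(Measure.pi fun _ => μ)
        = ((m : ℝ) / k) ^ 8 * ((k + 1 : ℕ) * (∫ z, |z| ^ ((8 : ℕ) / q : ℝ) ∂μ) ^ q)
          + (1 / γ) ^ 8 := by
      rw [integral_add (hsum.const_mul _) (integrable_const _), integral_const_mul,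
        integral_finsetSum _ fun a _ => integrable_block_prod hμ q a,
        Finset.sum_congr rfl fun a ha => integral_block_prod hq
          ((Nat.mul_le_mul_right q (Nat.succ_le_iff.2 (Finset.mem_range.1 ha))).trans hkm)]
      simp
    rw [hint]
    have h1 : (m : ℝ) / k ≤ m := div_le_self (by positivity) (by exact_mod_cast hk0)
    have h2 : ((k + 1 : ℕ) : ℝ) ≤ m := by exact_mod_cast hk
    have h3 : ((m : ℝ) / k) ^ 8 * ((k + 1 : ℕ) * (∫ z, |z| ^ ((8 : ℕ) / q : ℝ) ∂μ) ^ q)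
        ≤ (m : ℝ) ^ 8 * (m * (∫ z, |z| ^ ((8 : ℕ) / q : ℝ) ∂μ) ^ q) := by gcongr
    have h4 := mul_le_mul_of_nonneg_left h3 hlam.le
    linarith
  · filter_upwards [ae_pi_forall_le_zero (m := m) hneg] with e he hgood
    have h1 := mul_le_mul_of_nonneg_left (residualSpacing_le_of_mem_goodEvent x hb hk he hgood) hmk
    have h2 := mul_le_mul_of_nonneg_left
      (le_residualSpacing_of_mem_goodEvent x hb hk hw he hgood) hmk
    exact abs_le.2 ⟨by linarith, by linarith⟩
  · filter_upwards [ae_pi_forall_le_zero (m := m) hneg] with e he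
    have h0 := residualSpacing_nonneg x b hk e
    have h1 := pow_le_pow_left₀ h0 (residualSpacing_le x hb hk he) 8
    have h2 := mul_le_mul_of_nonneg_left (h1.trans (neg_orderStat_pow_le hq hkm hk he 8))
      (pow_nonneg hmk 8)
    rw [← mul_pow] at h2
    refine le_trans ?_ (add_le_add_left h2 _)
    have ha : 0 ≤ (m : ℝ) / k * residualSpacing x b k e := mul_nonneg hmk h0
    have hg : 0 ≤ 1 / γ := by positivity
    generalize (m : ℝ) / k * residualSpacing x b k e = u at ha ⊢
    generalize 1 / γ = v at hg ⊢
    rw [← Even.pow_abs (by decide : Even 8)]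
    -- For nonnegative `u`, `v` one has `|u - v| ≤ max u v`.
    rcases le_total u v with h | h
    · have := pow_le_pow_left₀ (abs_nonneg (u - v))
        (abs_le.2 ⟨by linarith, by linarith⟩ : |u - v| ≤ v) 8
      have : 0 ≤ u ^ 8 := by positivity
      linarith
    · have := pow_le_pow_left₀ (abs_nonneg (u - v))
        (abs_le.2 ⟨by linarith, by linarith⟩ : |u - v| ≤ u) 8
      have : 0 ≤ v ^ 8 := by positivity
      linarith

/-! ### Reduction to the product measure -/

theorem one_div_negHill_eq {n k : ℕ} (hn : Even n) (x ε : ℕ → ℝ) {b : ℝ} (hb : 0 < b)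
    {g : ℝ → ℝ} {c d : ℝ} (hg : ∀ t, g t = c + d * t) :
    1 / negHill n k x (fun i => g (x i) + ε i) b
      = ((n / 2 : ℕ) : ℝ) / k * residualSpacing (fun j : Fin (n / 2) => x (2 * ((j : ℕ) + 1))) b k
          (fun j => ε (2 * ((j : ℕ) + 1))) := by
  have h2 : (n : ℝ) = 2 * ((n / 2 : ℕ) : ℝ) := by
    exact_mod_cast (Nat.two_mul_div_two_of_even hn).symm
  have hres : boundaryResidual n x (fun i => g (x i) + ε i) b
      = localResidual (fun j : Fin (n / 2) => x (2 * ((j : ℕ) + 1))) b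
        (fun j => ε (2 * ((j : ℕ) + 1))) := by
    rw [boundaryResidual_eq_localResidual]
    simp only [hg]
    exact localResidual_affine _ hb _ c d
  -- The identity `1 / (a / d) = d / a` also holds for `d = 0`, where both sides are `0`, in
  -- agreement with the stated convention.
  rw [negHill, hres, one_div_div, residualSpacing]
  have h3 : 2 * (k : ℝ) / n = k / ((n / 2 : ℕ) : ℝ) := by
    rw [h2, mul_div_mul_left _ _ two_ne_zero]
  rw [h3, div_div_eq_mul_div, mul_comm, div_mul_eq_mul_div, mul_comm]

theorem map_even_errors_eq_pi {Ω : Type*} [MeasurableSpace Ω] {P : Measure Ω}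
    [IsProbabilityMeasure P] {μ : Measure ℝ} {n : ℕ} {ε : ℕ → Ω → ℝ}
    (hlaw : ∀ i ∈ Finset.Icc 1 n, HasLaw (ε i) μ P)
    (hindep : iIndepFun (fun i : Finset.Icc 1 n => ε i) P) :
    AEMeasurable (fun ω (j : Fin (n / 2)) => ε (2 * ((j : ℕ) + 1)) ω) P ∧
      P.map (fun ω (j : Fin (n / 2)) => ε (2 * ((j : ℕ) + 1)) ω) = Measure.pi fun _ => μ := by
  have hmem : ∀ j : Fin (n / 2), 2 * ((j : ℕ) + 1) ∈ Finset.Icc 1 n := fun j => by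
    have := j.2
    rw [Finset.mem_Icc]
    omega
  have hmeas : ∀ j : Fin (n / 2), AEMeasurable (ε (2 * ((j : ℕ) + 1))) P :=
    fun j => (hlaw _ (hmem j)).aemeasurable
  refine ⟨aemeasurable_pi_lambda _ hmeas, ?_⟩
  have hind : iIndepFun (fun j : Fin (n / 2) => ε (2 * ((j : ℕ) + 1))) P :=
    hindep.precomp (g := fun j : Fin (n / 2) => (⟨2 * ((j : ℕ) + 1), hmem j⟩ : Finset.Icc 1 n))
      fun i j hij => by
        have := congrArg Subtype.val hij
        simp only at this
        exact Fin.ext (by omega)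
  rw [(iIndepFun_iff_map_fun_eq_pi_map hmeas).1 hind]
  congr 1
  ext1 j
  exact (hlaw _ (hmem j)).map_eq

/-! ### Bounds for a fixed sample size -/

theorem half_le_of_sub_sq_le {G : ℝ → ℝ} {γ C z₀ : ℝ} (hC : 0 ≤ C) (hCz : C * z₀ ≤ γ / 2)
    (hG : ∀ z, 0 < z → γ * z - C * z ^ 2 ≤ G z) (z : ℝ) (hz : 0 < z) (hzz : z ≤ z₀) :
    γ * z / 2 ≤ G z := by
  have h1 := hG z hz
  have h2 := mul_le_mul_of_nonneg_left hzz hC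
  nlinarith

/-- `A` is a budget in units of `kδ`: `1` for the Chernoff margin, the terms with `8 / γ ^ 2` for
the quadratic errors, and the term with `R` for the radii. In the final factor `A / γ + 1`, the
extra `1` comes from `τ = kδ / m`. -/
theorem integral_spacing_pow_four_le_of_rates {m k q : ℕ} {x : Fin m → ℝ} {M b : ℝ} (hM : 0 ≤ M)
    (hb : 0 < b) (hx : ∀ i, |x i| ≤ M)
    {μ : Measure ℝ} [IsProbabilityMeasure μ] (hneg : ∀ᵐ z ∂μ, z < 0)
    (hq : 0 < q) (hkm : (k + 1) * q ≤ m) (hk0 : 0 < k) (hk : k < m)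
    (hμ : Integrable (fun z => |z| ^ ((8 : ℕ) / q : ℝ)) μ)
    {γ C z₀ : ℝ} (hγ : 0 < γ) (hC : 0 ≤ C) (hz₀ : 0 < z₀) (hz₁ : z₀ ≤ 1) (hCz : C * z₀ ≤ γ / 2)
    (hG₁ : ∀ z, 0 < z → γ * z - C * z ^ 2 ≤ μ.real (Set.Ioi (-z)))
    (hG₂ : ∀ z, 0 < z → μ.real (Set.Ioi (-z)) ≤ γ * z + C * z ^ 2)
    {A R w δ lam : ℝ} (hw : 0 < w) (hδ : 0 < δ) (hδ1 : δ ≤ 1) (hlam : 0 < lam) (hR : 0 ≤ R)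
    (hA : A = 1 + (C + (γ + 2 * C + z₀⁻¹)) * (8 / γ ^ 2) + (γ + 2 * C + z₀⁻¹) * R)
    (hAδ : A * δ ≤ 1 / 2) (hkδ : (k : ℝ) ≤ 2 * δ * m) (hτ : k * δ / m ≤ z₀)
    (hrad : w * (2 * ((2 * M / b + 2) * (1 + Real.log m))) ≤ R * (k * δ)) :
    Integrable (fun e => ((m : ℝ) / k * residualSpacing x b k e - 1 / γ) ^ 4)
        (Measure.pi fun _ : Fin m => μ) ∧
      ∫ e, ((m : ℝ) / k * residualSpacing x b k e - 1 / γ) ^ 4 ∂(Measure.pi fun _ : Fin m => μ)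
        ≤ ((A / γ + 1) * δ) ^ 4
          + lam * ((m : ℝ) ^ 9 * (∫ z, |z| ^ ((8 : ℕ) / q : ℝ) ∂μ) ^ q + (1 / γ) ^ 8)
          + lam⁻¹ * (2 * Real.exp (-(δ ^ 2 * k / 8)) + Real.exp (-(γ * (k * δ / m) / 2 * m))
              + 2 * (m * Real.exp (-(γ * w / 2)))) := by
  have hm : (0 : ℝ) < m := by exact_mod_cast (Nat.zero_le k).trans_lt hk
  have hkp : (0 : ℝ) < k := by exact_mod_cast hk0
  have hz : 0 < z₀⁻¹ := by positivity
  have hK : 0 ≤ γ + 2 * C + z₀⁻¹ := by positivity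
  set K := γ + 2 * C + z₀⁻¹
  have hA1 : 1 ≤ A := by
    rw [hA]
    have : 0 ≤ (C + K) * (8 / γ ^ 2) + K * R := by positivity
    linarith
  set s₁ := k / (m * γ) * (1 + A * δ) with hs₁
  set s₂ := k / (m * γ) * (1 - A * δ) with hs₂
  have hAδ0 : 0 ≤ A * δ := by positivity
  have hs₁0 : 0 < s₁ := by positivity
  have hs₂0 : 0 < s₂ := mul_pos (by positivity) (by linarith)
  -- The quadratic errors are of order `k² / m`, which `k ≤ 2δm` turns into order `kδ`.
  have hsq : ∀ t : ℝ, 0 ≤ t → t ≤ 2 → m * (k / (m * γ) * t) ^ 2 ≤ 8 / γ ^ 2 * (k * δ) := by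
    intro t ht0 ht2
    have h1 : t ^ 2 ≤ 4 := by nlinarith
    have h2 : m * (k / (m * γ) * t) ^ 2 = k * k / (m * γ ^ 2) * t ^ 2 := by
      field_simp
    rw [h2]
    calc k * k / (m * γ ^ 2) * t ^ 2 ≤ k * (2 * δ * m) / (m * γ ^ 2) * 4 := by gcongr
      _ = 8 / γ ^ 2 * (k * δ) := by
        field_simp
        ring
  have hms₁ : m * (γ * s₁) = k * (1 + A * δ) := by
    rw [hs₁]
    field_simp
  have hms₂ : m * (γ * s₂) = k * (1 - A * δ) := by
    rw [hs₂]
    field_simp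
  have hkδ0 : 0 ≤ k * δ := by positivity
  have hprob := measureReal_goodEvent_compl_le (k := k) x b (γ := γ) (s₁ := s₁) (s₂ := s₂)
    (τ := k * δ / m) (w := w) (z₀ := z₀) (a := δ) (μ := μ)
    (half_le_of_sub_sq_le hC hCz hG₁) hw hδ.le hδ1 (by positivity) hτ ?_ ?_
  · have hmain := integral_spacing_pow_four_le x hb hneg hq hkm hk0 hk hμ (s₁ := s₁) (s₂ := s₂)
      (τ := k * δ / m) (w := w) (z₀ := z₀) (D := (A / γ + 1) * δ) hγ hw.le hlam ?_ ?_
    · refine ⟨hmain.1, hmain.2.trans ?_⟩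
      have := mul_le_mul_of_nonneg_left hprob (inv_nonneg.2 hlam.le)
      linarith
    · have : (m : ℝ) / k * s₁ - 1 / γ = A / γ * δ := by
        rw [hs₁]
        field_simp
        ring
      rw [this]
      nlinarith
    · refine le_of_eq ?_
      rw [hs₂]
      field_simp
      ring
  · have h1 := mul_le_mul_of_nonneg_left (hG₁ s₁ hs₁0) hm.le
    have h2 := mul_le_mul_of_nonneg_left (hsq (1 + A * δ) (by linarith) (by linarith)) hC
    have h3 : 0 ≤ (K * (8 / γ ^ 2) + K * R) * (k * δ) := by positivity
    have h4 : A * (k * δ) = k * δ + (C + K) * (8 / γ ^ 2) * (k * δ) + K * R * (k * δ) := by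
      rw [hA]
      ring
    nlinarith
  · have h1 : ∑ i, μ.real (exceedSet x b w z₀ s₂ i)
        ≤ ∑ i : Fin m, (γ * s₂ + K * (cellRadius x b w i + s₂ ^ 2)) :=
      Finset.sum_le_sum fun i _ =>
        measureReal_exceedSet_le x b hγ.le hC hG₂ hw.le hs₂0 hz₀ hz₁ i
    have h2 : ∑ i : Fin m, (γ * s₂ + K * (cellRadius x b w i + s₂ ^ 2))
        = m * (γ * s₂) + K * (∑ i, cellRadius x b w i + m * s₂ ^ 2) := by
      rw [Finset.sum_add_distrib, ← Finset.mul_sum (f := fun i => cellRadius x b w i + s₂ ^ 2),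
        Finset.sum_add_distrib]
      simp
    have h3 : ∑ i, cellRadius x b w i ≤ R * (k * δ) := by
      simp only [cellRadius]
      rw [← Finset.mul_sum]
      exact (mul_le_mul_of_nonneg_left (sum_inv_card_inCell_le hM hb hx) hw.le).trans hrad
    have h5 := hsq (1 - A * δ) (by linarith) (by linarith)
    have h6 := mul_le_mul_of_nonneg_left (add_le_add h3 h5) hK
    have h7 : 0 ≤ C * (8 / γ ^ 2) * (k * δ) := by positivity
    have h8 : A * (k * δ) = k * δ + (C + K) * (8 / γ ^ 2) * (k * δ) + K * R * (k * δ) := by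
      rw [hA]
      ring
    refine h1.trans ?_
    rw [h2, hms₂]
    linarith

/-- The number of design cells, up to a logarithm, is negligible against `y = k * δ`. -/
theorem cell_count_le {b u y C₀ M l : ℝ} (hM : 0 ≤ M) (hb : 0 < b) (hu : 1 ≤ u) (hy : u ^ 10 ≤ y)
    (hl : l ≤ u) (hC₀ : 1 ≤ C₀) (hby : (b ^ 5)⁻¹ ≤ C₀ * y ^ 4) :
    u * (2 * ((2 * M / b + 2) * l)) ≤ (4 * M * C₀ + 4) * y := by
  have hu0 : 0 ≤ u := by linarith
  have hy0 : 0 ≤ y := (by positivity : (0 : ℝ) ≤ u ^ 10).trans hy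
  have h1 : u ^ 2 ≤ y := (pow_le_pow_right₀ hu (by norm_num)).trans hy
  have h2 : u ^ 2 / b ≤ C₀ * y := by
    -- Fifth powers match the exponent of `b` in the rate condition; the spare factor `u ^ 10 ≤ y`
    -- supplies the missing power of `y`.
    refine le_of_pow_le_pow_left₀ (n := 5) (by norm_num) (by positivity) ?_
    calc (u ^ 2 / b) ^ 5 = u ^ 10 * (b ^ 5)⁻¹ := by
          rw [div_pow]
          ring
      _ ≤ y * (C₀ * y ^ 4) := by gcongr
      _ = C₀ ^ 1 * y ^ 5 := by ring
      _ ≤ C₀ ^ 5 * y ^ 5 := by (gcongr; norm_num)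
      _ = (C₀ * y) ^ 5 := by ring
  calc u * (2 * ((2 * M / b + 2) * l)) ≤ u * (2 * ((2 * M / b + 2) * u)) := by gcongr
    _ = 4 * M * (u ^ 2 / b) + 4 * u ^ 2 := by ring
    _ ≤ 4 * M * (C₀ * y) + 4 * y := by gcongr
    _ = (4 * M * C₀ + 4) * y := by ring

/-! ### Asymptotic comparisons in the sample size -/

theorem eventually_pow_mul_exp_neg_le_one {β c : ℝ} (hβ : 0 < β) (hc : 0 < c) (r : ℕ) :
    ∀ᶠ n : ℕ in atTop, (n : ℝ) ^ r * Real.exp (-(c * (n : ℝ) ^ β)) ≤ 1 := by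
  have h1 : Tendsto (fun n : ℕ => (n : ℝ) ^ β) atTop atTop :=
    (tendsto_rpow_atTop hβ).comp tendsto_natCast_atTop_atTop
  have h2 := (tendsto_rpow_mul_exp_neg_mul_atTop_nhds_zero (r / β) c hc).comp h1
  filter_upwards [h2.eventually_le_const zero_lt_one] with n hn
  simp only [Function.comp] at hn
  rw [← Real.rpow_mul (by positivity), mul_div_cancel₀ _ hβ.ne', Real.rpow_natCast, neg_mul] at hn
  exact hn

theorem eventually_one_add_log_le_rpow {β : ℝ} (hβ : 0 < β) :
    ∀ᶠ n : ℕ in atTop, 1 + Real.log n ≤ (n : ℝ) ^ β := by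
  have h1 : (fun t : ℝ => 1 + Real.log t) =o[atTop] fun t => t ^ β :=
    ((isLittleO_const_left.2 (Or.inr (tendsto_norm_atTop_atTop.comp (tendsto_rpow_atTop hβ)))).add
      (isLittleO_log_rpow_atTop hβ))
  filter_upwards [(tendsto_natCast_atTop_atTop (R := ℝ)).eventually (h1.bound zero_lt_one)]
    with n hn
  rw [one_mul, Real.norm_of_nonneg (by positivity : (0 : ℝ) ≤ (n : ℝ) ^ β)] at hn
  exact (Real.le_norm_self _).trans hn

/-- With `λ = n^(-11)`, the moment term `λ m^9` is of order `n^(-2)`, while `λ⁻¹` times a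
probability of order `n E` is controlled by `n^14 E ≤ 1`. Finally `N ≤ n`. -/
theorem remainder_le {n m lam A₁ A₂ E p N D : ℝ} (hn : 1 ≤ n) (hm0 : 0 ≤ m) (hmn : 2 * m = n)
    (hlam : lam = (n ^ 11)⁻¹) (hA₁ : 0 ≤ A₁) (hA₂ : 0 ≤ A₂)
    (hp : p ≤ 2 * E + E + 2 * (m * E)) (hE0 : 0 ≤ E) (hE : n ^ 14 * E ≤ 1) (hN : 0 < N)
    (hNn : N ≤ n) :
    D * (N ^ 2)⁻¹ + lam * (m ^ 9 * A₁ + A₂) + lam⁻¹ * p ≤ (D + A₁ + A₂ + 4) * (N ^ 2)⁻¹ := by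
  have hn0 : 0 < n := by linarith
  have h1 : (n ^ 2)⁻¹ ≤ (N ^ 2)⁻¹ := by gcongr
  have h2 : lam * (m ^ 9 * A₁ + A₂) ≤ (n ^ 2)⁻¹ * (A₁ + A₂) := by
    rw [hlam]
    calc (n ^ 11)⁻¹ * (m ^ 9 * A₁ + A₂) ≤ (n ^ 11)⁻¹ * (n ^ 9 * A₁ + n ^ 9 * A₂) := by
          have : m ≤ n := by linarith
          have h9 : 1 ≤ n ^ 9 := one_le_pow₀ hn
          have := le_mul_of_one_le_left hA₂ h9
          gcongr
      _ = (n ^ 2)⁻¹ * (A₁ + A₂) := by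
          field_simp
  have h3 : lam⁻¹ * p ≤ 4 * (n ^ 2)⁻¹ := by
    rw [hlam, inv_inv]
    calc n ^ 11 * p ≤ n ^ 11 * (4 * n * E) := by
          gcongr
          nlinarith
      _ = 4 * (n ^ 2)⁻¹ * (n ^ 14 * E) := by
          field_simp
      _ ≤ 4 * (n ^ 2)⁻¹ * 1 := by gcongr
      _ = 4 * (n ^ 2)⁻¹ := mul_one _
  have h4 := mul_le_mul_of_nonneg_right h1 (by positivity : 0 ≤ A₁ + A₂)
  linarith

/-! ### Choice of constants and rates -/

theorem mainTheorem7
    {Ω : ℕ → Type*} [∀ n, MeasurableSpace (Ω n)]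
    (P : ∀ n, Measure (Ω n)) [∀ n, IsProbabilityMeasure (P n)]
    -- errors: for each sample size `n`, i.i.d. with law `μ`, almost surely negative
    (μ : Measure ℝ) [IsProbabilityMeasure μ] (hneg : ∀ᵐ z ∂μ, z < 0)
    (ε : ∀ n, ℕ → Ω n → ℝ)
    (hlaw : ∀ n, ∀ i ∈ Finset.Icc 1 n, HasLaw (ε n i) μ (P n))
    (hindep : ∀ n, iIndepFun (fun i : Finset.Icc 1 n => ε n i) (P n))
    -- the distribution function at the endpoint `0` and at `-∞`
    (γ : ℝ) (hγ : 0 < γ)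
    (hdistr : ∃ CF : ℝ, ∀ z < 0, |cdf μ z - (1 - γ * |z|)| ≤ CF * |z| ^ 2)
    (htail : ∃ Γ > 0, ∃ C > 0, ∀ t < 0, cdf μ t ≤ C * |t| ^ (-Γ : ℝ))
    -- affine regression function
    (g : ℝ → ℝ) (hg : ∃ c d : ℝ, ∀ t, g t = c + d * t)
    -- bandwidths and number of order statistics
    (h h₁ : ℕ → ℝ) (k : ℕ → ℕ)
    (hpos : ∀ n, 0 < h n) (h₁pos : ∀ n, 0 < h₁ n) (kpos : ∀ n, 0 < k n)
    (hzero : Tendsto h evenTop (𝓝 0))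
    (hnh : Tendsto (fun n : ℕ => (n : ℝ) * h n) evenTop atTop)
    -- design
    (x : ℕ → ℕ → ℝ) (hx : ∃ M : ℝ, ∀ n, ∀ i ∈ Finset.Icc 1 n, |x n i| ≤ M)
    (hscatter : 0 < scatterConstant x h)
    -- rates
    (hrate₁ : IsBoundedUnder (· ≤ ·) evenTop
      (fun n : ℕ => (n : ℝ) ^ 2 * h n ^ 2 / (h₁ n ^ 5 * (k n : ℝ) ^ 4)))
    (hrate₂ : ∃ α > (0 : ℝ), Tendsto
      (fun n : ℕ => (n : ℝ) ^ α * ((n : ℝ) * h n / (k n : ℝ))) evenTop (𝓝 0))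
    (hrate₃ : Tendsto (fun n : ℕ => (k n : ℝ) ^ 2 * h n / (n : ℝ)) evenTop (𝓝 0)) :
    (∀ᶠ n in evenTop, Integrable (fun ω =>
      (1 / negHill n (k n) (x n) (fun i => g (x n i) + ε n i ω) (h₁ n) - 1 / γ) ^ 4) (P n)) ∧
    (fun n : ℕ => ∫ ω,
      (1 / negHill n (k n) (x n) (fun i => g (x n i) + ε n i ω) (h₁ n) - 1 / γ) ^ 4 ∂(P n))
      =O[evenTop] (fun n : ℕ => ((n : ℝ) * h n) ^ (-2 : ℤ)) := by
  obtain ⟨CF, hCF⟩ := hdistr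
  obtain ⟨Γ, hΓ, Ct, -, hCt⟩ := htail
  obtain ⟨c₁, d₁, hg⟩ := hg
  obtain ⟨M₀, hM₀⟩ := hx
  obtain ⟨C₀, hC₀⟩ := hrate₁
  obtain ⟨α, hα, hrate₂⟩ := hrate₂
  rw [eventually_map] at hC₀
  -- Blocks of length `q` give `8 / q < Γ`, so the required moment exists however small `Γ` is.
  obtain ⟨q, hq⟩ := exists_nat_gt (8 / Γ)
  have hq0 : 0 < q := by
    have : (0 : ℝ) < q := (by positivity : 0 < 8 / Γ).trans hq
    exact_mod_cast this
  have hq0' : (0 : ℝ) < q := by exact_mod_cast hq0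
  have hμ : Integrable (fun z => |z| ^ ((8 : ℕ) / q : ℝ)) μ := by
    refine integrable_abs_rpow_of_cdf_le hneg hCt (by positivity) ?_
    rw [div_lt_iff₀ hΓ] at hq
    rw [div_lt_iff₀ hq0']
    push_cast
    linarith
  obtain ⟨C, hCF_le, hC⟩ : ∃ C, CF ≤ C ∧ 0 < C :=
    ⟨max CF 1, le_max_left _ _, lt_max_of_lt_right one_pos⟩
  obtain ⟨M, hM_le, hM⟩ : ∃ M, M₀ ≤ M ∧ 0 ≤ M := ⟨max M₀ 0, le_max_left _ _, le_max_right _ _⟩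
  obtain ⟨C₁, hC₀_le, hC₁⟩ : ∃ C₁, C₀ ≤ C₁ ∧ 1 ≤ C₁ :=
    ⟨max C₀ 1, le_max_left _ _, le_max_right _ _⟩
  have hcdf : ∀ z, 0 < z → |μ.real (Set.Ioi (-z)) - γ * z| ≤ C * z ^ 2 := fun z hz => by
    have h1 := hCF (-z) (by linarith)
    have h2 : μ.real (Set.Ioi (-z)) = 1 - cdf μ (-z) := by
      rw [cdf_eq_real, ← Set.compl_Iic, probReal_compl_eq_one_sub measurableSet_Iic]
    rw [abs_neg, abs_of_pos hz] at h1
    rw [h2, abs_sub_comm, show γ * z - (1 - cdf μ (-z)) = cdf μ (-z) - (1 - γ * z) by ring]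
    exact h1.trans (by gcongr)
  obtain ⟨z₀, hz₀, hz₁, hCz⟩ : ∃ z₀ : ℝ, 0 < z₀ ∧ z₀ ≤ 1 ∧ C * z₀ ≤ γ / 2 := by
    refine ⟨min 1 (γ / (2 * C)), lt_min one_pos (by positivity), min_le_left _ _, ?_⟩
    refine (mul_le_mul_of_nonneg_left (min_le_right _ _) hC.le).trans (le_of_eq ?_)
    field_simp
  obtain ⟨R, hR⟩ : ∃ R, R = 4 * M * C₁ + 4 := ⟨_, rfl⟩
  have hR0 : 0 ≤ R := by
    rw [hR]
    positivity
  obtain ⟨A, hA⟩ : ∃ A, A = 1 + (C + (γ + 2 * C + z₀⁻¹)) * (8 / γ ^ 2)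
    + (γ + 2 * C + z₀⁻¹) * R := ⟨_, rfl⟩
  have hA0 : 0 ≤ A := by
    rw [hA]
    positivity
  obtain ⟨c, hc, hc8, hcγ⟩ : ∃ c : ℝ, 0 < c ∧ c ≤ 1 / 8 ∧ c ≤ γ / 2 :=
    ⟨min (1 / 8) (γ / 2), lt_min (by norm_num) (by positivity), min_le_left _ _, min_le_right _ _⟩
  have hβ : 0 < α / 10 := by positivity
  set I := ∫ z, |z| ^ ((8 : ℕ) / q : ℝ) ∂μ
  have hI : 0 ≤ I := integral_nonneg fun z => by positivity
  have key : ∀ᶠ n in evenTop, (Integrable (fun ω =>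
      (1 / negHill n (k n) (x n) (fun i => g (x n i) + ε n i ω) (h₁ n) - 1 / γ) ^ 4) (P n)) ∧
      ∫ ω, (1 / negHill n (k n) (x n) (fun i => g (x n i) + ε n i ω) (h₁ n) - 1 / γ) ^ 4 ∂(P n)
        ≤ ((A / γ + 1) ^ 4 + I ^ q + (1 / γ) ^ 8 + 4) * (((n : ℝ) * h n) ^ 2)⁻¹ := by
    have hle : evenTop ≤ atTop := inf_le_left
    have heven : ∀ᶠ n in evenTop, Even n := mem_inf_of_right (mem_principal_self _)
    -- The summands of the threshold for `√(nh)` serve separately: `δ ≤ 1`, `Aδ ≤ 1 / 2`, `4qδ ≤ 1`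
    -- (the blocks fit into the sample) and `2δ ≤ z₀`.
    filter_upwards [heven, hle (eventually_ge_atTop 1),
      hle (eventually_pow_mul_exp_neg_le_one hβ hc 14), hle (eventually_one_add_log_le_rpow hβ),
      hC₀, hrate₂.eventually_le_const one_pos, hrate₃.eventually_le_const one_pos,
      hzero.eventually_le_const one_pos,
      (Real.tendsto_sqrt_atTop.comp hnh).eventually_ge_atTop (1 + 2 * A + 4 * q + 2 / z₀)]
      with n hev hn1 hexp hlog hr₁ hr₂ hr₃ hh hN
    simp only [Function.comp] at hN
    obtain ⟨m, hmdef⟩ : ∃ m, m = n / 2 := ⟨_, rfl⟩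
    have hn1' : (1 : ℝ) ≤ n := by exact_mod_cast hn1
    have hn0 : (0 : ℝ) < n := by linarith
    have hmn : 2 * (m : ℝ) = n := by
      rw [hmdef]
      exact_mod_cast Nat.two_mul_div_two_of_even hev
    have hkp : (0 : ℝ) < k n := by exact_mod_cast kpos n
    have hb := h₁pos n
    have hNpos : 0 < (n : ℝ) * h n := mul_pos hn0 (hpos n)
    have hNn : (n : ℝ) * h n ≤ n := mul_le_of_le_one_right hn0.le hh
    have hSsq := Real.sq_sqrt hNpos.le
    obtain ⟨S, hS⟩ : ∃ S, S = √((n : ℝ) * h n) := ⟨_, rfl⟩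
    obtain ⟨N, hNdef⟩ : ∃ N, N = (n : ℝ) * h n := ⟨_, rfl⟩
    rw [← hS] at hN hSsq
    rw [← hNdef] at hSsq hNpos hNn hr₂ ⊢
    have hq1 : (1 : ℝ) ≤ q := by exact_mod_cast hq0
    have hz2 : 0 < 2 / z₀ := by positivity
    have hS1 : 1 ≤ S := by linarith
    have hS0 : 0 < S := by linarith
    have hδsq : (S⁻¹) ^ 2 = N⁻¹ := by rw [inv_pow, hSsq]
    have hδ0 : 0 < S⁻¹ := by positivity
    have hδ1 : S⁻¹ ≤ 1 := inv_le_one_of_one_le₀ hS1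
    -- The bound `k² h ≤ n`, multiplied by `n`, reads `k² (nh) ≤ n²`.
    have hkn : (k n : ℝ) ≤ S⁻¹ * n := by
      rw [inv_mul_eq_div, le_div_iff₀ hS0]
      refine le_of_pow_le_pow_left₀ two_ne_zero hn0.le ?_
      rw [div_le_one hn0] at hr₃
      calc ((k n : ℝ) * S) ^ 2 = (n : ℝ) * ((k n : ℝ) ^ 2 * h n) := by
            rw [mul_pow, hSsq, hNdef]
            ring
        _ ≤ (n : ℝ) * n := by gcongr
        _ = (n : ℝ) ^ 2 := by ring
    have hkm2 : (k n : ℝ) ≤ 2 * S⁻¹ * m := by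
      rw [← hmn] at hkn
      linarith
    have hm0 : (0 : ℝ) < m := by linarith
    have hkqm : (k n + 1) * q ≤ m := by
      have h1 : ((k n : ℝ) + 1) * q ≤ m := by
        have h2 : 4 * (q : ℝ) * S⁻¹ ≤ 1 := by
          rw [← div_eq_mul_inv, div_le_one hS0]
          linarith
        have h3 : (1 : ℝ) ≤ k n := by exact_mod_cast kpos n
        calc ((k n : ℝ) + 1) * q ≤ (2 * (2 * S⁻¹ * m)) * q := by
              gcongr
              linarith
          _ = (4 * q * S⁻¹) * m := by ring
          _ ≤ 1 * m := by gcongr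
          _ = m := one_mul _
      exact_mod_cast h1
    have hkltm : k n < m := lt_of_lt_of_le (Nat.lt_succ_self _)
      ((Nat.le_mul_of_pos_right _ hq0).trans hkqm)
    have hAδ : A * S⁻¹ ≤ 1 / 2 := by
      rw [← div_eq_mul_inv, div_le_div_iff₀ hS0 two_pos]
      linarith
    have hτ : k n * S⁻¹ / m ≤ z₀ := by
      have h1 : 2 * S⁻¹ ≤ z₀ := by
        have : 2 / z₀ ≤ S := by linarith
        rw [div_le_iff₀ hz₀] at this
        rw [← div_eq_mul_inv, div_le_iff₀ hS0]
        linarith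
      rw [div_le_iff₀ hm0]
      calc k n * S⁻¹ ≤ k n * 1 := by gcongr
        _ ≤ 2 * S⁻¹ * m := by rwa [mul_one]
        _ ≤ z₀ * m := by gcongr
    -- `u` serves as the width `w`, dominates the logarithm, and satisfies `u ^ 10 = n ^ α ≤ k /
    -- (nh)`; the exponent `α / 10` is the one needed by `cell_count_le`.
    obtain ⟨u, hu⟩ : ∃ u, u = (n : ℝ) ^ (α / 10) := ⟨_, rfl⟩
    have hu1 : 1 ≤ u := hu ▸ Real.one_le_rpow hn1' hβ.le
    rw [← hu] at hexp hlog
    have hu10 : u ^ 10 ≤ k n * N⁻¹ := by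
      have h1 : u ^ 10 = (n : ℝ) ^ α := by
        rw [hu, ← Real.rpow_mul_natCast hn0.le]
        congr 1
        push_cast
        ring
      rw [← mul_div_assoc, div_le_one hkp] at hr₂
      rw [h1, ← div_eq_mul_inv, le_div_iff₀ hNpos]
      exact hr₂
    have hNδ : (k n : ℝ) * N⁻¹ ≤ k n * S⁻¹ := by
      rw [← hδsq]
      gcongr
      exact pow_le_of_le_one hδ0.le hδ1 two_ne_zero
    have hlogm : 1 + Real.log m ≤ u := by
      have := Real.log_le_log hm0 (by linarith : (m : ℝ) ≤ n)
      linarith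
    -- Since `(nh)^(-2) = δ^4`, the first rate condition says `h₁^(-5) ≤ C₁ (kδ)^4`.
    have hrad := cell_count_le (b := h₁ n) (C₀ := C₁) hM hb hu1 (hu10.trans hNδ) hlogm hC₁ (by
      have h1 : ((k n : ℝ) * S⁻¹) ^ 4 = (k n : ℝ) ^ 4 * (N ^ 2)⁻¹ := by
        rw [mul_pow, show (S⁻¹) ^ 4 = ((S⁻¹) ^ 2) ^ 2 by ring, hδsq, inv_pow]
      have h2 : (h₁ n ^ 5)⁻¹ = (n : ℝ) ^ 2 * h n ^ 2 / (h₁ n ^ 5 * (k n : ℝ) ^ 4)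
          * ((k n : ℝ) ^ 4 * (N ^ 2)⁻¹) := by
        rw [← mul_pow, ← hNdef]
        field_simp
      rw [h1, h2]
      exact mul_le_mul_of_nonneg_right (hr₁.trans hC₀_le) (by positivity))
    rw [← hR] at hrad
    have hx' : ∀ j : Fin m, |x n (2 * ((j : ℕ) + 1))| ≤ M := fun j => by
      refine (hM₀ n _ ?_).trans hM_le
      have := j.2
      rw [Finset.mem_Icc]
      omega
    have hmain := integral_spacing_pow_four_le_of_rates
      (x := fun j : Fin m => x n (2 * ((j : ℕ) + 1))) hM hb hx' hneg hq0 hkqm (kpos n) hkltm hμ hγ hC.le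
      hz₀ hz₁ hCz (fun z hz => by linarith [(abs_le.1 (hcdf z hz)).1])
      (fun z hz => by linarith [(abs_le.1 (hcdf z hz)).2])
      (by linarith : 0 < u) hδ0 hδ1 (lam := ((n : ℝ) ^ 11)⁻¹) (by positivity) hR0 hA hAδ hkm2 hτ
      hrad
    have hE : ∀ t, c * u ≤ t → Real.exp (-t) ≤ Real.exp (-(c * u)) := fun t ht =>
      Real.exp_le_exp.2 (neg_le_neg ht)
    have hu_le : u ≤ k n * N⁻¹ := (le_self_pow₀ hu1 (by norm_num)).trans hu10
    have hp : 2 * Real.exp (-(S⁻¹ ^ 2 * k n / 8)) + Real.exp (-(γ * (k n * S⁻¹ / m) / 2 * m))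
        + 2 * (m * Real.exp (-(γ * u / 2))) ≤ 2 * Real.exp (-(c * u)) + Real.exp (-(c * u))
          + 2 * (m * Real.exp (-(c * u))) := by
      have hu0 : 0 ≤ u := by linarith
      gcongr ?_ + ?_ + 2 * (m * ?_)
      · refine mul_le_mul_of_nonneg_left (hE _ ?_) two_pos.le
        rw [hδsq]
        have := mul_le_mul hc8 hu_le hu0 (by norm_num)
        linarith
      · refine hE _ ?_
        have h1 : γ * (k n * S⁻¹ / m) / 2 * m = γ / 2 * (k n * S⁻¹) := by field_simp
        rw [h1]
        exact mul_le_mul hcγ (hu_le.trans hNδ) hu0 (by positivity)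
      · refine hE _ ?_
        have := mul_le_mul_of_nonneg_right hcγ hu0
        linarith
    have hrem := remainder_le (D := (A / γ + 1) ^ 4) hn1' hm0.le hmn rfl (pow_nonneg hI q)
      (by positivity : 0 ≤ (1 / γ) ^ 8) hp (Real.exp_nonneg _) hexp hNpos hNn
    rw [mul_pow (A / γ + 1), show (S⁻¹) ^ 4 = ((S⁻¹) ^ 2) ^ 2 by ring, hδsq, inv_pow] at hmain
    rw [hδsq] at hrem
    subst hmdef
    obtain ⟨hmeas, hmap⟩ := map_even_errors_eq_pi (hlaw n) (hindep n)
    rw [← hmap] at hmain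
    have hΦ : Measurable fun e : Fin (n / 2) → ℝ => (((n / 2 : ℕ) : ℝ) / k n *
        residualSpacing (fun j : Fin (n / 2) => x n (2 * ((j : ℕ) + 1))) (h₁ n) (k n) e
          - 1 / γ) ^ 4 :=
      (((measurable_residualSpacing _ hb hkltm).const_mul _).sub_const _).pow_const _
    rw [integrable_map_measure hΦ.aestronglyMeasurable hmeas,
      integral_map hmeas hΦ.aestronglyMeasurable] at hmain
    have heq : ∀ ω, 1 / negHill n (k n) (x n) (fun i => g (x n i) + ε n i ω) (h₁ n)
        = ((n / 2 : ℕ) : ℝ) / k n * residualSpacing (fun j : Fin (n / 2) => x n (2 * ((j : ℕ) + 1)))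
          (h₁ n) (k n) (fun j => ε n (2 * ((j : ℕ) + 1)) ω) := fun ω =>
      one_div_negHill_eq hev (x n) (fun i => ε n i ω) hb hg
    simp only [heq]
    exact ⟨hmain.1, hmain.2.trans hrem⟩
  refine ⟨key.mono fun n hn => hn.1, IsBigO.of_bound
    ((A / γ + 1) ^ 4 + I ^ q + (1 / γ) ^ 8 + 4) (key.mono fun n hn => ?_)⟩
  rw [Real.norm_of_nonneg (integral_nonneg fun ω => by positivity), zpow_neg,
    Real.norm_of_nonneg (inv_nonneg.2 (zpow_nonneg (mul_nonneg n.cast_nonneg (hpos n).le) _))]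
  exact_mod_cast hn.2
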